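/- **Setting.** There are $K\ge 2$ arms $a_1,\dots,a_K$, a time horizon $T$, and $M\ge1$ stationary segments $S_m=\{\nu_{m-1},\dots,\nu_m-1\}$, where $1=\nu_0<\nu_1<\dots<\nu_{M-1}<\nu_M=T+1$. In segment $S_m$ the preference matrix is $P^{(m)}=(p^{(m)}_{i,j})\in[0,1]^{K\times K}$ with $p^{(m)}_{i,j}+p^{(m)}_{j,i}=1$, and there is a Condorcet winner $a_{m^*}$, i.e. $p^{(m)}_{m^*,i}>\frac12$ for all $i\ne m^*$. A duel of the pair $(a_i,a_j)$ at a time $t\in S_m$ is won by $a_i$ with probability $p^{(m)}_{i,j}$, independently of everything else. With $\Delta^{(m)}_i:=p^{(m)}_{m^*,i}-\frac12$, the binary weak regret of playing $(a_{I_t},a_{J_t})$ at time $t\in S_m$ is $\lceil\min\{\Delta^{(m)}_{I_t},\Delta^{(m)}_{J_t}\}\rceil$, and $R^{\bar{\mathrm W}}(T)$ is its sum over $t=1,\dots,T$. **DETECT.** Let $Alg$ be any (possibly randomized) dueling bandits algorithm which chooses pairs on the basis of the duels observed since its initialization and can at any time name a suspected Condorcet winner. DETECT has parameters $\tilde T\in\mathbb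 N$, an even window length $w\ge2$, a threshold $b>0$ and, for each arm $a_i$, a fixed ordering of the other arms. It repeats the following cycle until time $T$: it runs a freshly initialized $Alg$ for $\tilde T$ steps and obtains its suspected Condorcet winner $a_I$; then it plays the pairs $(a_I,a_j)$, $j\neq I$, in round-robin fashion in the fixed ordering, until, for the pair just played, at least $w$ outcomes have been observed in the current detection phase and the numbers of wins of $a_I$ in the first and in the second half of the last $w$ of these outcomes differ in absolute value by more than $b$. At this step the changepoint detection is triggered and the cycle restarts in the next step. Let $L':=w(K-1)$ and $\delta^{(m)}_*:=\max_j|p^{(m+1)}_{m^*,j}-p^{(m)}_{m^*,j}|$ for $1\le m\le M-1$. Assume 1. $|S_m|\ge\tilde T+\frac32L'$ for all $m\in\{1,\dots,M\}$; 2. there is $c>0$ with $\delta_*^{(m)}\ge\frac{2b}{w}+c$ for all $m\in\{1,\dots,M-1\}$. Let $p_{\tilde T}$ be a real number such that, for every $m\le M$, the probability that $Alg$, run for $\tilde T$ steps in the stationary setting with preference matrix $P^{(m)}$, names $a_{m^*}$ as suspected Condorcet winner is at least $p_{\tilde T}$. For DETECT initialized at time $\nu_{m-1}$ let $\tau_m$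 be the time step at which the changepoint detection is triggered for the first time ($\tau_m=\infty$ if this does not happen up to time $T$), and let $a_{I_m}$ be the first suspected Condorcet winner returned by $Alg$. **Theorem.** Let $p,q\in[0,1]$ be such that $$\mathbb P(\tau_m<\nu_m\mid a_{I_m}=a_{m^*})\le p\quad\text{for all } m\le M,$$ $$\mathbb P(\tau_m\ge\nu_m+L'/2\mid\tau_m\ge\nu_m,\ a_{I_m}=a_{m^*})\le q\quad\text{for all } m\le M-1,$$ where a condition is void if the conditioning event has probability $0$. Then the expected cumulative binary weak regret of DETECT, initialized at time $1$, satisfies $$\mathbb E\big[R^{\bar{\mathrm W}}(T)\big]\le\frac{ML'}2+(1-p_{\tilde T}+p\,p_{\tilde T}+q)\,MT+\sum_{m=1}^M\mathbb E\big[\tilde R^{\bar{\mathrm W}}(\nu_{m-1},\nu_{m-1}+\tilde T-1)\big],$$ where $\tilde R^{\bar{\mathrm W}}(t_1,t_2)$ denotes the cumulative binary weak regret that $Alg$ incurs when it is initialized at time $t_1$ and run on its own on the time steps $t_1,\dots,t_2$. -/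

import Mathlib

noncomputable section

namespace DuelingBandits

/-! ## Discrete probability -/

/-- Expectation of `f` under the discrete law `μ` (all subsets are measurable). -/
def expect {α : Type*} (μ : PMF α) (f : α → ℝ) : ℝ :=
  letI : MeasurableSpace α := ⊤
  MeasureTheory.integral μ.toMeasure f

/-- Conditional probability of `A` given `B` under the discrete law `μ`. -/
def condProb {α : Type*} (μ : PMF α) (A B : Set α) : ℝ :=
  letI : MeasurableSpace α := ⊤
  (ProbabilityTheory.cond μ.toMeasure B).real A

/-! ## The non-stationary dueling bandits problem -/

/-- A problem instance with `K` arms, horizon `T`, and `M` stationary segments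
`S_m = {ν (m-1), …, ν m - 1}`, `1 ≤ m ≤ M`, where `ν 0 = 1` and `ν M = T + 1`.  Only the values
`ν 0, …, ν M`, `pref 1, …, pref M` and `cw 1, …, cw M` matter. -/
structure Problem (K : ℕ) where
  /-- time horizon -/
  T : ℕ
  /-- number of stationary segments -/
  M : ℕ
  /-- changepoints -/
  ν : ℕ → ℕ
  /-- `pref m i j` is the probability that arm `i` beats arm `j` in segment `m` -/
  pref : ℕ → Fin K → Fin K → unitInterval
  /-- the Condorcet winner of each segment -/
  cw : ℕ → Fin K
  one_le_M : 1 ≤ M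
  ν_zero : ν 0 = 1
  ν_last : ν M = T + 1
  ν_lt : ∀ m < M, ν m < ν (m + 1)
  pref_add : ∀ m, 1 ≤ m → m ≤ M → ∀ i j, (pref m i j : ℝ) + (pref m j i : ℝ) = 1
  cw_beats : ∀ m, 1 ≤ m → m ≤ M → ∀ i, i ≠ cw m → (1 / 2 : ℝ) < (pref m (cw m) i : ℝ)

namespace Problem

variable {K : ℕ} (E : Problem K)

/-- The index `m` of the segment containing the time step `t`, for `1 ≤ t ≤ T`: the number of
`k ∈ {0, …, M - 1}` with `ν k ≤ t`. -/
def seg (t : ℕ) : ℕ := ((Finset.range E.M).filter fun k => E.ν k ≤ t).card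

/-- The length `|S_m|` of the `m`-th segment. -/
def segLen (m : ℕ) : ℕ := E.ν m - E.ν (m - 1)

/-- The preference matrix in force at time `t`. -/
def prefAt (t : ℕ) : Fin K → Fin K → unitInterval := E.pref (E.seg t)

/-- The suboptimality gap of arm `i` in segment `m`. -/
def gap (m : ℕ) (i : Fin K) : ℝ := (E.pref m (E.cw m) i : ℝ) - 1 / 2

/-- The binary weak regret of playing the pair `(i, j)` at time `t`. -/
def weakRegret (t : ℕ) (i j : Fin K) : ℝ :=
  (⌈min (E.gap (E.seg t) i) (E.gap (E.seg t) j)⌉ : ℤ)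

/-- The largest change, at the `m`-th changepoint, of a winning probability of the Condorcet
winner of segment `m`. -/
def deltaStar (m : ℕ) : ℝ :=
  ⨆ j : Fin K, |(E.pref (m + 1) (E.cw m) j : ℝ) - (E.pref m (E.cw m) j : ℝ)|

end Problem

/-! ## The black-box algorithm -/

/-- An observed duel `(i, j, x)`: the pair `(i, j)` was played, and `x = true` iff `i` won. -/
abbrev Duel (K : ℕ) := Fin K × Fin K × Bool

/-- The random outcome of a duel in which the first arm wins with probability `p`. -/
def duelOutcome (p : unitInterval) : PMF Bool :=
  PMF.ofFintype
    (fun x => if x = true then ENNReal.ofReal (p : ℝ) else ENNReal.ofReal (1 - (p : ℝ))) (by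
      have h0 : (0 : ℝ) ≤ p := p.2.1
      have h1 : (0 : ℝ) ≤ 1 - p := sub_nonneg.2 p.2.2
      simp [← ENNReal.ofReal_add h0 h1])

/-- An arbitrary, possibly randomized, dueling bandits algorithm.  Given what it has observed since
its initialization (most recent duel first), it has a conditional law for the pair it plays next
and a conditional law for the arm that it names as suspected Condorcet winner.  Resetting it means
going back to the empty history. -/
structure Algorithm (K : ℕ) where
  choose : List (Duel K) → PMF (Fin K × Fin K)
  suspect : List (Duel K) → PMF (Fin K)

namespace Algorithm

variable {K : ℕ} (A : Algorithm K)

/-- One time step of the algorithm with history `h` facing the preference matrix `P`: it chooses a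
pair and receives the outcome. -/
def runAndFeed (P : Fin K → Fin K → unitInterval) (h : List (Duel K)) : PMF (Duel K) :=
  (A.choose h).bind fun ij => (duelOutcome (P ij.1 ij.2)).map fun x => (ij.1, ij.2, x)

/-- The law of the history (most recent duel first) when the algorithm is run on its own for `n`
time steps, starting at time `t₀`, with preference matrix `P t` at time `t`. -/
def run (P : ℕ → Fin K → Fin K → unitInterval) (t₀ : ℕ) : ℕ → PMF (List (Duel K))
  | 0 => PMF.pure []
  | n + 1 => (run P t₀ n).bind fun h => (A.runAndFeed (P (t₀ + n)) h).map fun d => d :: h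

/-- The probability that the suspected Condorcet winner named after `n` time steps is the arm `i`,
in the stationary setting with preference matrix `P`. -/
def identProb (P : Fin K → Fin K → unitInterval) (n : ℕ) (i : Fin K) : ℝ :=
  (((A.run (fun _ => P) 1 n).bind A.suspect) i).toReal

/-- The cumulative binary weak regret of a history (most recent duel first) begun at time `t₀`. -/
def histRegret (E : Problem K) (t₀ : ℕ) : List (Duel K) → ℝ
  | [] => 0
  | d :: h => E.weakRegret (t₀ + h.length) d.1 d.2.1 + histRegret E t₀ h

/-- The expected cumulative binary weak regret that the algorithm incurs when it is run on its own
on the time steps `t₀, …, t₀ + n - 1`. -/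
def expRegret (E : Problem K) (t₀ n : ℕ) : ℝ :=
  expect (A.run E.prefAt t₀ n) (histRegret E t₀)

end Algorithm

/-! ## DETECT -/

/-- The parameters of DETECT: length `Ttil` of the running phases, window length `w`, threshold
`b`, and, for each arm `i`, an ordering `order i 0, …, order i (K - 2)` of the other arms. -/
structure Params (K : ℕ) where
  Ttil : ℕ
  w : ℕ
  b : ℝ
  order : Fin K → ℕ → Fin K
  w_pos : 0 < w
  w_even : Even w
  b_pos : 0 < b
  order_bij : ∀ i, Set.BijOn (order i) (Set.Iio (K - 1)) {i}ᶜ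

/-- The number `w (K - 1)` of time steps that fill all detection windows. -/
def Params.L {K : ℕ} (D : Params K) : ℕ := D.w * (K - 1)

/-- The detection test for a pair with outcomes `l` (most recent first): at least `w` outcomes are
there, and the win counts in the two halves of the last `w` outcomes differ by more than `b`. -/
def Params.triggers {K : ℕ} (D : Params K) (l : List Bool) : Prop :=
  D.w ≤ l.length ∧
    D.b < |((((l.drop (D.w / 2)).take (D.w / 2)).count true : ℕ) : ℝ) -
      (((l.take (D.w / 2)).count true : ℕ) : ℝ)|

/-- What is recorded about one time step. -/
structure Round (K : ℕ) where
  /-- the time step -/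
  time : ℕ
  /-- first arm played -/
  fst : Fin K
  /-- second arm played -/
  snd : Fin K
  /-- the suspected Condorcet winner in use, if this is a detection step -/
  cand : Option (Fin K)
  /-- whether the changepoint detection is triggered in this step -/
  alarm : Bool

/-- The state of DETECT between two time steps. -/
inductive State (K : ℕ)
  /-- the algorithm has been running since the last reset and has seen the history `h` -/
  | running (h : List (Duel K)) : State K
  /-- detection phase with suspected Condorcet winner `i`; `d` detection steps are done, and
  `obs j` lists the outcomes of the pair `(i, j)` in this phase, most recent first -/
  | detecting (i : Fin K) (d : ℕ) (obs : Fin K → List Bool) : State K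

/-- The state at initialization and after a reset. -/
def State.init {K : ℕ} : State K := State.running []

open Classical in
/-- One detection step at time `t` with preference matrix `P`. -/
def detectStep {K : ℕ} (D : Params K) (P : Fin K → Fin K → unitInterval) (t : ℕ)
    (i : Fin K) (d : ℕ) (obs : Fin K → List Bool) : PMF (Round K × State K) :=
  let j := D.order i (d % (K - 1))
  (duelOutcome (P i j)).map fun x =>
    let obs' := Function.update obs j (x :: obs j)
    if D.triggers (obs' j) then (⟨t, i, j, some i, true⟩, State.init)
    else (⟨t, i, j, some i, false⟩, State.detecting i (d + 1) obs')

/-- One time step of DETECT at time `t` with preference matrix `P`. -/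
def step {K : ℕ} (D : Params K) (A : Algorithm K) (P : Fin K → Fin K → unitInterval) (t : ℕ) :
    State K → PMF (Round K × State K)
  | .running h =>
      if h.length < D.Ttil then
        (A.runAndFeed P h).map fun x => (⟨t, x.1, x.2.1, none, false⟩, State.running (x :: h))
      else
        (A.suspect h).bind fun i => detectStep D P t i 0 fun _ => []
  | .detecting i d obs => detectStep D P t i d obs

/-- The law of the rounds (in chronological order) of `n` time steps of DETECT in the environment
`E`, the first of them at time `t`, from a given state. -/
def runFrom {K : ℕ} (D : Params K) (A : Algorithm K) (E : Problem K) :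
    ℕ → ℕ → State K → PMF (List (Round K))
  | 0, _, _ => PMF.pure []
  | n + 1, t, s =>
      (step D A (E.prefAt t) t s).bind fun r =>
        (runFrom D A E n (t + 1) r.2).map fun ω => r.1 :: ω

/-- The law of the rounds `t₀, …, T` of DETECT initialized at time `t₀`. -/
def detect {K : ℕ} (D : Params K) (A : Algorithm K) (E : Problem K) (t₀ : ℕ) :
    PMF (List (Round K)) :=
  runFrom D A E (E.T + 1 - t₀) t₀ State.init

/-- The first time step at which the changepoint detection is triggered (`⊤` if there is none). -/
def alarmTime {K : ℕ} : List (Round K) → ℕ∞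
  | [] => ⊤
  | r :: ω => if r.alarm then (r.time : ℕ∞) else alarmTime ω

/-- The first suspected Condorcet winner that the black-box algorithm returns, if any. -/
def firstSuspect {K : ℕ} : List (Round K) → Option (Fin K)
  | [] => none
  | r :: ω => r.cand.or (firstSuspect ω)

/-- The cumulative binary weak regret of a sequence of rounds. -/
def totalRegret {K : ℕ} (E : Problem K) (ω : List (Round K)) : ℝ :=
  (ω.map fun r => E.weakRegret r.time r.fst r.snd).sum

/-- The event that the first suspected Condorcet winner is the Condorcet winner of segment `m`. -/
def correctEvent {K : ℕ} (E : Problem K) (m : ℕ) : Set (List (Round K)) :=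
  {ω | firstSuspect ω = some (E.cw m)}

end DuelingBandits

end

noncomputable section

namespace DuelingBandits

open scoped ENNReal

/-! Write `H` for half of `D.L` and `κ = 1 - pT + p * pT + q`. The bound follows from a backward
recursion over the segments: started at any time `t` with `ν (m-1) ≤ t ≤ ν (m-1) + H`, DETECT has
expected remaining regret at most the sum over `k ≥ m` of the black-box regret in segment `k`, plus
`H`, plus `κ * T`. The tolerance `H` is forced, because the restart after a detected changepoint may
come up to `H` steps late.

Before the last segment, call a run good if the named arm is right, no alarm comes before `ν m`, and
one comes within the next `H` steps. In a good run the detection steps before `ν m` cost nothing,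
since the Condorcet winner takes part in each duel; the delay costs at most `H`; the rest is covered
by the recursion. A bad run costs at most `T` more. In the last segment, good means that the arm is
right and no alarm comes. Let `c` be the identification probability and `U`, `V` the probabilities,
given the right arm, of no alarm before `ν m` and before `ν m + H`. A good run has probability `c *
(U - V)`, which the hypotheses bound below by `(1 - q) * (1 - p) * c`; so bad runs have probability
at most `κ` (`one_sub_mul_le`).

The hypotheses only concern a start at `ν (m-1)`, so it remains to see that a late start does not
decrease `U - V` (`survAll_sub_le_survAll_sub`). Given the arm, different pairs have independent
outcomes, so the probability of no alarm is a product over pairs (`prob_le_alarmTime_detecting`,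
`survAll_succ`). For one pair, an earlier start inserts additional oldest outcomes with the
pre-change law. These can only add early alarms, and they have left the window once `w` newer
outcomes are present, which the segment length guarantees before the changepoint. Hence an earlier
start can only lower the probability that the first alarm falls after the change
(`surv_replicate_sub_le`), and `prod_sub_prod_le_prod_sub_prod` passes from single pairs to the
product. -/

/-- The expectation of a nonnegative function under a discrete law. -/
def ev {α : Type*} (μ : PMF α) (f : α → ℝ≥0∞) : ℝ≥0∞ := ∑' a, μ a * f a

/-! ### Expectations under discrete laws as sums in `ℝ≥0∞` -/

section ev

variable {α β : Type*} (μ : PMF α)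

theorem ev_pure (a : α) (f : α → ℝ≥0∞) : ev (PMF.pure a) f = f a := by
  unfold ev
  rw [tsum_eq_single a]
  · simp
  · intro b hb
    simp [hb]

theorem ev_bind (k : α → PMF β) (f : β → ℝ≥0∞) :
    ev (μ.bind k) f = ev μ fun a => ev (k a) f := by
  simp only [ev, PMF.bind_apply, ← ENNReal.tsum_mul_right, ← ENNReal.tsum_mul_left]
  rw [ENNReal.tsum_comm]
  simp only [mul_assoc]

theorem ev_map (g : α → β) (f : β → ℝ≥0∞) : ev (μ.map g) f = ev μ fun a => f (g a) := by
  rw [PMF.map, ev_bind]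
  simp only [Function.comp_apply, ev_pure]

theorem ev_congr {f g : α → ℝ≥0∞} (h : ∀ a ∈ μ.support, f a = g a) : ev μ f = ev μ g := by
  refine tsum_congr fun a => ?_
  by_cases ha : μ a = 0
  · simp [ha]
  · rw [h a ((PMF.mem_support_iff _ _).2 ha)]

theorem ev_mono {f g : α → ℝ≥0∞} (h : ∀ a ∈ μ.support, f a ≤ g a) : ev μ f ≤ ev μ g := by
  refine ENNReal.tsum_le_tsum fun a => ?_
  by_cases ha : μ a = 0
  · simp [ha]
  · gcongr
    exact h a ((PMF.mem_support_iff _ _).2 ha)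

theorem ev_add (f g : α → ℝ≥0∞) : (ev μ fun a => f a + g a) = ev μ f + ev μ g := by
  simp only [ev, mul_add, ENNReal.tsum_add]

theorem ev_const (c : ℝ≥0∞) : (ev μ fun _ => c) = c := by
  simp only [ev, ENNReal.tsum_mul_right, PMF.tsum_coe, one_mul]

theorem toMeasure_eq_sum_dirac [MeasurableSpace α] :
    μ.toMeasure = MeasureTheory.Measure.sum fun a => μ a • MeasureTheory.Measure.dirac a := by
  ext s hs
  rw [PMF.toMeasure_apply _ hs, MeasureTheory.Measure.sum_apply _ hs]
  refine tsum_congr fun a => ?_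
  by_cases ha : a ∈ s <;> simp [ha, hs]

/-- Nonnegativity is asked only on the support: a round at time `0` lies in no segment, and its
regret has no sign. -/
theorem expect_eq_toReal_ev {f : α → ℝ} (hf : ∀ a ∈ μ.support, 0 ≤ f a) :
    expect μ f = (ev μ fun a => ENNReal.ofReal (f a)).toReal := by
  let _ : MeasurableSpace α := ⊤
  change MeasureTheory.integral μ.toMeasure f = _
  rw [MeasureTheory.integral_eq_lintegral_of_nonneg_ae]
  · rw [toMeasure_eq_sum_dirac, MeasureTheory.lintegral_sum_measure]
    simp [ev]
  · rw [Filter.EventuallyLE, MeasureTheory.ae_iff,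
      PMF.toMeasure_apply_eq_zero_iff _ MeasurableSpace.measurableSet_top,
      Set.disjoint_left]
    intro a ha h
    exact h (hf a ha)
  · exact (measurable_from_top : Measurable f).aestronglyMeasurable

/-- The probability of an event. -/
def prob (S : Set α) : ℝ≥0∞ := ev μ (S.indicator 1)

theorem prob_ne_top (S : Set α) : prob μ S ≠ ∞ := by
  refine ne_top_of_le_ne_top ENNReal.one_ne_top ?_
  rw [← ev_const μ 1]
  refine ev_mono _ fun a _ => ?_
  by_cases ha : a ∈ S <;> simp [ha]

theorem toMeasure_eq_prob (S : Set α) :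
    (letI : MeasurableSpace α := ⊤; μ.toMeasure S) = prob μ S := by
  let _ : MeasurableSpace α := ⊤
  rw [PMF.toMeasure_apply _ MeasurableSpace.measurableSet_top]
  refine tsum_congr fun a => ?_
  by_cases ha : a ∈ S <;> simp [ha]

theorem prob_inter_le_of_condProb_le {A B : Set α} {p : ℝ} (h : condProb μ A B ≤ p) :
    (prob μ (B ∩ A)).toReal ≤ p * (prob μ B).toReal := by
  let _ : MeasurableSpace α := ⊤
  have e1 := toMeasure_eq_prob μ (B ∩ A)
  have e2 := toMeasure_eq_prob μ B
  change μ.toMeasure _ = _ at e1 e2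
  rw [← e1, ← e2]
  change (ProbabilityTheory.cond μ.toMeasure B).real A ≤ p at h
  rw [MeasureTheory.measureReal_def,
    ProbabilityTheory.cond_apply MeasurableSpace.measurableSet_top, ENNReal.toReal_mul,
    ENNReal.toReal_inv] at h
  -- A null conditioning event makes both sides vanish, so a void condition still yields the product
  -- form.
  rcases (ENNReal.toReal_nonneg (a := μ.toMeasure B)).eq_or_lt with h0 | h0
  · rw [← h0, mul_zero, h0]
    exact ENNReal.toReal_mono (MeasureTheory.measure_ne_top _ _)
      (MeasureTheory.measure_mono Set.inter_subset_left)
  · rwa [inv_mul_le_iff₀ h0, mul_comm] at h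

theorem sum_toReal_eq_one [Fintype α] : ∑ a, (μ a).toReal = 1 := by
  rw [← ENNReal.toReal_sum fun a _ => μ.apply_ne_top a, ← tsum_fintype (L := .unconditional _),
    μ.tsum_coe, ENNReal.toReal_one]

theorem ev_le_ofReal_sum [Fintype α] {f : α → ℝ≥0∞} {g : α → ℝ} (hg : ∀ a, 0 ≤ g a)
    (h : ∀ a, f a ≤ ENNReal.ofReal (g a)) :
    ev μ f ≤ ENNReal.ofReal (∑ a, (μ a).toReal * g a) := by
  rw [ENNReal.ofReal_sum_of_nonneg fun a _ => mul_nonneg ENNReal.toReal_nonneg (hg a), ev,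
    tsum_fintype]
  refine Finset.sum_le_sum fun a _ => ?_
  rw [ENNReal.ofReal_mul ENNReal.toReal_nonneg, ENNReal.ofReal_toReal (μ.apply_ne_top a)]
  gcongr
  exact h a

end ev

theorem ev_duelOutcome (p : unitInterval) (f : Bool → ℝ≥0∞) :
    ev (duelOutcome p) f =
      ENNReal.ofReal p * f true + ENNReal.ofReal (1 - p) * f false := by
  simp [ev, duelOutcome, tsum_fintype]

variable {K : ℕ}

/-! ### The detection test of a single pair -/

open Classical in
/-- The probability that the detection test for one pair never triggers while outcomes with
success probabilities `ps` are added to the outcomes `o`. -/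
def Params.surv (D : Params K) : List unitInterval → List Bool → ℝ
  | [], _ => 1
  | p :: ps, o =>
      (p : ℝ) * (if D.triggers (true :: o) then 0 else D.surv ps (true :: o)) +
        (1 - (p : ℝ)) * (if D.triggers (false :: o) then 0 else D.surv ps (false :: o))

namespace Params

variable (D : Params K)

theorem half_add_half : D.w / 2 + D.w / 2 = D.w := by
  obtain ⟨r, hr⟩ := D.w_even
  omega

/-- Lists have the most recent outcome first, so `o ++ [y]` adds an oldest outcome; the test reads
only the newest `w` entries. -/
theorem triggers_append_singleton {o : List Bool} (ho : D.w ≤ o.length) (y : Bool) :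
    D.triggers (o ++ [y]) ↔ D.triggers o := by
  have h := D.half_add_half
  unfold triggers
  rw [List.drop_append_of_le_length (by omega), List.take_append_of_le_length (by simp; omega),
    List.take_append_of_le_length (by omega)]
  simp only [ho, List.length_append, List.length_singleton, true_and, and_iff_right_iff_imp]
  omega

theorem triggers.append_singleton {D : Params K} {o : List Bool} (h : D.triggers o) (y : Bool) :
    D.triggers (o ++ [y]) :=
  (D.triggers_append_singleton h.1 y).2 h

theorem surv_mem (ps : List unitInterval) (o : List Bool) :
    0 ≤ D.surv ps o ∧ D.surv ps o ≤ 1 := by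
  induction ps generalizing o with
  | nil => simp [surv]
  | cons p ps ih =>
    have h0 : (0 : ℝ) ≤ p := p.2.1
    have h1 : (p : ℝ) ≤ 1 := p.2.2
    have hx : ∀ x : Bool, 0 ≤ (open Classical in if D.triggers (x :: o) then 0 else D.surv ps (x :: o)) ∧
        (open Classical in if D.triggers (x :: o) then 0 else D.surv ps (x :: o)) ≤ 1 := by
      intro x
      split_ifs
      · simp
      · exact ih _
    have ht := hx true
    have hf := hx false
    simp only [surv]
    constructor
    · exact add_nonneg (mul_nonneg h0 ht.1) (mul_nonneg (by linarith) hf.1)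
    · nlinarith [mul_le_mul_of_nonneg_left ht.2 h0, mul_le_mul_of_nonneg_left hf.2 (sub_nonneg.2 h1)]

/-- An additional oldest outcome preserves every trigger and may fill the window earlier. -/
theorem surv_append_singleton_le (ps : List unitInterval) (o : List Bool) (y : Bool) :
    D.surv ps (o ++ [y]) ≤ D.surv ps o := by
  induction ps generalizing o with
  | nil => simp [surv]
  | cons p ps ih =>
    have h0 : (0 : ℝ) ≤ p := p.2.1
    have h1 : (0 : ℝ) ≤ 1 - p := sub_nonneg.2 p.2.2
    simp only [surv, ← List.cons_append]
    gcongr ?_ * ?_ + ?_ * ?_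
    all_goals
      split_ifs with h2 h3 h3
      · exact le_rfl
      · exact (D.surv_mem _ _).1
      · exact absurd (h3.append_singleton y) h2
      · exact ih _

theorem surv_append_singleton_of_le_length (ps : List unitInterval) {o : List Bool}
    (ho : D.w ≤ o.length) (y : Bool) : D.surv ps (o ++ [y]) = D.surv ps o := by
  induction ps generalizing o with
  | nil => simp [surv]
  | cons p ps ih =>
    have ht : D.w ≤ (true :: o).length := by simp; omega
    have hf : D.w ≤ (false :: o).length := by simp; omega
    rw [surv, surv, ← List.cons_append, ← List.cons_append, ih ht, ih hf,
      propext (D.triggers_append_singleton ht y), propext (D.triggers_append_singleton hf y)]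

theorem surv_append_le (ps qs : List unitInterval) (o : List Bool) :
    D.surv (ps ++ qs) o ≤ D.surv ps o := by
  induction ps generalizing o with
  | nil => simpa [surv] using (D.surv_mem _ _).2
  | cons p ps ih =>
    have h0 : (0 : ℝ) ≤ p := p.2.1
    have h1 : (0 : ℝ) ≤ 1 - p := sub_nonneg.2 p.2.2
    simp only [surv, List.cons_append]
    gcongr ?_ * ?_ + ?_ * ?_
    all_goals
      split_ifs
      · exact le_rfl
      · exact ih _

/-- The difference is the probability that the first trigger falls in `qs`. An older outcome `y` can
move a first trigger into `ps`, but is invisible during `qs`, because the window is full of newer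
outcomes by then. -/
theorem surv_sub_surv_append_singleton_le (ps qs : List unitInterval) {o : List Bool}
    (ho : D.w ≤ o.length + ps.length) (y : Bool) :
    D.surv ps (o ++ [y]) - D.surv (ps ++ qs) (o ++ [y]) ≤ D.surv ps o - D.surv (ps ++ qs) o := by
  induction ps generalizing o with
  | nil =>
    rw [List.nil_append, D.surv_append_singleton_of_le_length qs (by simpa using ho)]
    simp [surv]
  | cons p ps ih =>
    have h0 : (0 : ℝ) ≤ p := p.2.1
    have h1 : (0 : ℝ) ≤ 1 - p := sub_nonneg.2 p.2.2
    simp only [surv, List.cons_append]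
    simp only [← List.cons_append]
    simp only [add_sub_add_comm, ← mul_sub]
    gcongr ?_ * ?_ + ?_ * ?_
    all_goals
      split_ifs with h2 h3 h3
      · exact le_rfl
      · rw [sub_zero]
        exact sub_nonneg.2 (D.surv_append_le _ _ _)
      · exact absurd (h3.append_singleton y) h2
      · refine ih ?_
        simp at ho ⊢
        omega

/-- Conditioning on the first of the `n + 1` outcomes turns it into an oldest outcome placed before
the same `n` outcomes; the bound for each of its values is then averaged. -/
theorem surv_replicate_succ_le (a : unitInterval) (n : ℕ) (qs : List unitInterval) :
    D.surv (List.replicate (n + 1) a ++ qs) [] ≤ D.surv (List.replicate n a ++ qs) [] := by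
  have h0 : (0 : ℝ) ≤ a := a.2.1
  have h1 : (0 : ℝ) ≤ 1 - a := sub_nonneg.2 a.2.2
  rw [List.replicate_succ, List.cons_append, surv]
  set ps := List.replicate n a ++ qs
  have hx : ∀ x : Bool, (open Classical in if D.triggers [x] then 0 else D.surv ps [x]) ≤
      D.surv ps [] := by
    intro x
    split_ifs
    · exact (D.surv_mem _ _).1
    · exact D.surv_append_singleton_le ps [] x
  nlinarith [mul_le_mul_of_nonneg_left (hx true) h0, mul_le_mul_of_nonneg_left (hx false) h1]

theorem surv_replicate_succ_sub_le (a : unitInterval) {n : ℕ} (hn : D.w ≤ n)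
    (qs : List unitInterval) :
    D.surv (List.replicate (n + 1) a) [] - D.surv (List.replicate (n + 1) a ++ qs) [] ≤
      D.surv (List.replicate n a) [] - D.surv (List.replicate n a ++ qs) [] := by
  have h0 : (0 : ℝ) ≤ a := a.2.1
  have h1 : (0 : ℝ) ≤ 1 - a := sub_nonneg.2 a.2.2
  rw [List.replicate_succ, List.cons_append, surv, surv, add_sub_add_comm, ← mul_sub, ← mul_sub]
  set ps := List.replicate n a with hps
  have hx : ∀ x : Bool, (open Classical in if D.triggers [x] then 0 else D.surv ps [x]) -
      (open Classical in if D.triggers [x] then 0 else D.surv (ps ++ qs) [x]) ≤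
      D.surv ps [] - D.surv (ps ++ qs) [] := by
    intro x
    split_ifs
    · simpa using D.surv_append_le ps qs []
    · exact D.surv_sub_surv_append_singleton_le ps qs (o := []) (by simpa [hps] using hn) x
  nlinarith [mul_le_mul_of_nonneg_left (hx true) h0, mul_le_mul_of_nonneg_left (hx false) h1]

theorem surv_replicate_antitone (a : unitInterval) (qs : List unitInterval) :
    Antitone fun n => D.surv (List.replicate n a ++ qs) [] :=
  antitone_nat_of_succ_le fun n => D.surv_replicate_succ_le a n qs

theorem surv_replicate_sub_le (a : unitInterval) (qs : List unitInterval) {n n' : ℕ}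
    (hn : D.w ≤ n) (h : n ≤ n') :
    D.surv (List.replicate n' a) [] - D.surv (List.replicate n' a ++ qs) [] ≤
      D.surv (List.replicate n a) [] - D.surv (List.replicate n a ++ qs) [] := by
  induction n', h using Nat.le_induction with
  | base => exact le_rfl
  | succ k hk ih => exact (D.surv_replicate_succ_sub_le a (hn.trans hk) qs).trans ih

end Params

/-- Telescoping: the difference for an inserted factor is `(u a - v a) * ∏ u + v a * (∏ u - ∏ v)`,
and all four factors are nonnegative and monotone. -/
theorem prod_sub_prod_le_prod_sub_prod {ι : Type*} (s : Finset ι) {u v u' v' : ι → ℝ}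
    (hv : ∀ j, 0 ≤ v j) (hvu : ∀ j, v j ≤ u j) (hu' : ∀ j, u j ≤ u' j) (hv' : ∀ j, v j ≤ v' j)
    (h : ∀ j, u j - v j ≤ u' j - v' j) :
    ∏ j ∈ s, u j - ∏ j ∈ s, v j ≤ ∏ j ∈ s, u' j - ∏ j ∈ s, v' j := by
  classical
  induction s using Finset.induction_on with
  | empty => simp
  | insert a s ha ih =>
    simp only [Finset.prod_insert ha]
    have h1 : ∏ j ∈ s, u j ≤ ∏ j ∈ s, u' j :=
      Finset.prod_le_prod (fun j _ => (hv j).trans (hvu j)) fun j _ => hu' j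
    have h0 : 0 ≤ ∏ j ∈ s, u j := Finset.prod_nonneg fun j _ => (hv j).trans (hvu j)
    have h2 : ∏ j ∈ s, v j ≤ ∏ j ∈ s, u j := Finset.prod_le_prod (fun j _ => hv j) fun j _ => hvu j
    have e1 : (u a - v a) * ∏ j ∈ s, u j ≤ (u' a - v' a) * ∏ j ∈ s, u' j :=
      mul_le_mul (h a) h1 h0 ((sub_nonneg.2 (hvu a)).trans (h a))
    have e2 : v a * (∏ j ∈ s, u j - ∏ j ∈ s, v j) ≤
        v' a * (∏ j ∈ s, u' j - ∏ j ∈ s, v' j) :=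
      mul_le_mul (hv' a) ih (sub_nonneg.2 h2) ((hv a).trans (hv' a))
    linarith

/-! ### Round-robin sampling and independence of the pairs -/

/-- The success probabilities of the duels of the pair `(i, j)` in `n` detection steps from time
`t`, of which the first is the step number `d` of the detection phase. -/
def samples (D : Params K) (E : Problem K) (i j : Fin K) : ℕ → ℕ → ℕ → List unitInterval
  | 0, _, _ => []
  | n + 1, t, d =>
      if D.order i (d % (K - 1)) = j then E.prefAt t i j :: samples D E i j n (t + 1) (d + 1)
      else samples D E i j n (t + 1) (d + 1)

/-- The probability that no alarm is raised in `n` detection steps. -/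
def survAll (D : Params K) (E : Problem K) (i : Fin K) (n t d : ℕ) (obs : Fin K → List Bool) : ℝ :=
  ∏ j, D.surv (samples D E i j n t d) (obs j)

section survAll

variable (D : Params K) (E : Problem K) (i : Fin K)

theorem survAll_mem (n t d : ℕ) (obs : Fin K → List Bool) :
    0 ≤ survAll D E i n t d obs ∧ survAll D E i n t d obs ≤ 1 :=
  ⟨Finset.prod_nonneg fun _ _ => (D.surv_mem _ _).1,
    Finset.prod_le_one (fun _ _ => (D.surv_mem _ _).1) fun _ _ => (D.surv_mem _ _).2⟩

theorem survAll_zero (t d : ℕ) (obs : Fin K → List Bool) : survAll D E i 0 t d obs = 1 := by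
  simp [survAll, samples, Params.surv]

open Classical in
-- A detection step touches the outcomes of one pair only, so only that factor of the product is
-- unfolded. This is where independence of the pairs enters.
theorem survAll_succ (n t d : ℕ) (obs : Fin K → List Bool) (j : Fin K)
    (hj : D.order i (d % (K - 1)) = j) :
    survAll D E i (n + 1) t d obs =
      (E.prefAt t i j : ℝ) * (if D.triggers (true :: obs j) then 0 else
        survAll D E i n (t + 1) (d + 1) (Function.update obs j (true :: obs j))) +
      (1 - (E.prefAt t i j : ℝ)) * (if D.triggers (false :: obs j) then 0 else
        survAll D E i n (t + 1) (d + 1) (Function.update obs j (false :: obs j))) := by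
  subst hj
  set j := D.order i (d % (K - 1)) with hj
  have key : ∀ x : Bool, survAll D E i n (t + 1) (d + 1) (Function.update obs j (x :: obs j)) =
      D.surv (samples D E i j n (t + 1) (d + 1)) (x :: obs j) *
        ∏ k ∈ Finset.univ.erase j, D.surv (samples D E i k n (t + 1) (d + 1)) (obs k) := by
    intro x
    rw [survAll, ← Finset.mul_prod_erase _ _ (Finset.mem_univ j), Function.update_self]
    congr 1
    refine Finset.prod_congr rfl fun k hk => ?_
    rw [Function.update_of_ne (Finset.ne_of_mem_erase hk)]
  have key2 : survAll D E i (n + 1) t d obs =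
      D.surv (E.prefAt t i j :: samples D E i j n (t + 1) (d + 1)) (obs j) *
        ∏ k ∈ Finset.univ.erase j, D.surv (samples D E i k n (t + 1) (d + 1)) (obs k) := by
    rw [survAll, ← Finset.mul_prod_erase _ _ (Finset.mem_univ j)]
    congr 1
    · rw [samples, if_pos hj.symm]
    · refine Finset.prod_congr rfl fun k hk => ?_
      rw [samples, if_neg]
      rw [← hj]
      exact (Finset.ne_of_mem_erase hk).symm
  rw [key, key, key2, Params.surv]
  split_ifs <;> ring

theorem samples_add (j : Fin K) (n n' t d : ℕ) :
    samples D E i j (n + n') t d =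
      samples D E i j n t d ++ samples D E i j n' (t + n) (d + n) := by
  induction n generalizing t d with
  | zero => simp [samples]
  | succ n ih =>
    rw [show n + 1 + n' = (n + n') + 1 by ring, samples, samples, ih,
      show t + 1 + n = t + (n + 1) by ring, show d + 1 + n = d + (n + 1) by ring]
    split_ifs <;> simp

theorem samples_eq_replicate (j : Fin K) (P : Fin K → Fin K → unitInterval) (n t d : ℕ)
    (hP : ∀ k < n, E.prefAt (t + k) = P) :
    samples D E i j n t d =
      List.replicate (Nat.count (fun k => D.order i ((d + k) % (K - 1)) = j) n) (P i j) := by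
  induction n generalizing t d with
  | zero => simp [samples]
  | succ n ih =>
    have h0 : E.prefAt t = P := hP 0 (Nat.succ_pos n)
    have h1 := ih (t + 1) (d + 1) fun k hk => by
      rw [add_right_comm, add_assoc]
      exact hP (k + 1) (by omega)
    rw [samples, h1, Nat.count_succ', h0]
    simp only [add_zero, add_assoc, add_comm 1]
    split_ifs <;> simp [List.replicate_succ]

theorem count_order_self (hK : 2 ≤ K) (d n : ℕ) :
    Nat.count (fun k => D.order i ((d + k) % (K - 1)) = i) n = 0 := by
  rw [Nat.count_eq_card_filter_range, Finset.card_eq_zero, Finset.filter_eq_empty_iff]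
  intro k _
  exact (D.order_bij i).mapsTo (Nat.mod_lt _ (by omega) : (d + k) % (K - 1) < K - 1)

theorem count_order_period {j : Fin K} (hj : j ≠ i) (d : ℕ) :
    Nat.count (fun k => D.order i ((d + k) % (K - 1)) = j) (K - 1) = 1 := by
  have h0 : Nat.count (fun k => D.order i (k % (K - 1)) = j) (K - 1) = 1 := by
    rw [Nat.count_eq_card_filter_range, Finset.card_eq_one]
    obtain ⟨r, hr, hrj⟩ := (D.order_bij i).surjOn (show j ∈ ({i} : Set (Fin K))ᶜ from hj)
    refine ⟨r, ?_⟩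
    ext k
    simp only [Finset.mem_filter, Finset.mem_range, Finset.mem_singleton]
    constructor
    · rintro ⟨hk, hkj⟩
      rw [Nat.mod_eq_of_lt hk] at hkj
      exact (D.order_bij i).injOn hk hr (hkj.trans hrj.symm)
    · rintro rfl
      exact ⟨hr, by rw [Nat.mod_eq_of_lt hr]; exact hrj⟩
  -- Splitting the first `d + (K - 1)` steps in two ways shows that the count over a full cycle does
  -- not depend on the offset `d`.
  have h1 := Nat.count_add (fun k => D.order i (k % (K - 1)) = j) d (K - 1)
  have h2 := Nat.count_add (fun k => D.order i (k % (K - 1)) = j) (K - 1) d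
  simp only [Nat.add_mod_left] at h2
  rw [add_comm (K - 1) d, h1] at h2
  omega

theorem count_order_mul_period {j : Fin K} (hj : j ≠ i) (d r : ℕ) :
    Nat.count (fun k => D.order i ((d + k) % (K - 1)) = j) (r * (K - 1)) = r := by
  induction r with
  | zero => simp
  | succ r ih =>
    rw [Nat.succ_mul, Nat.count_add, ih]
    simp only [← add_assoc]
    rw [count_order_period D i hj]

end survAll

/-! ### Comparison of an early and a late start of the detection phase -/

theorem Params.L_half (D : Params K) : D.L / 2 = D.w / 2 * (K - 1) := by
  have h := D.half_add_half
  unfold Params.L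
  rw [← h, add_mul, ← two_mul, Nat.mul_div_cancel_left _ two_pos, ← two_mul,
    Nat.mul_div_cancel_left _ two_pos]

section coupling

variable (D : Params K) (E : Problem K) (i : Fin K)

theorem survAll_le_survAll {N N' t t' : ℕ} {P : Fin K → Fin K → unitInterval}
    (hN : N ≤ N') (ht : ∀ k < N, E.prefAt (t + k) = P) (ht' : ∀ k < N', E.prefAt (t' + k) = P) :
    survAll D E i N' t' 0 (fun _ => []) ≤ survAll D E i N t 0 fun _ => [] := by
  refine Finset.prod_le_prod (fun j _ => (D.surv_mem _ _).1) fun j _ => ?_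
  rw [samples_eq_replicate D E i j P N t 0 ht, samples_eq_replicate D E i j P N' t' 0 ht']
  simpa using D.surv_replicate_antitone (P i j) [] (Nat.count_monotone _ hN)

theorem survAll_sub_le_survAll_sub (hK : 2 ≤ K) {N N' t t' : ℕ}
    {P P' : Fin K → Fin K → unitInterval} (hL : D.L ≤ N) (hN : N ≤ N')
    (htt' : t' + N' = t + N) (ht : ∀ k < N, E.prefAt (t + k) = P)
    (ht' : ∀ k < N', E.prefAt (t' + k) = P) (hP' : ∀ k < D.L / 2, E.prefAt (t + N + k) = P') :
    survAll D E i N' t' 0 (fun _ => []) - survAll D E i (N' + D.L / 2) t' 0 (fun _ => []) ≤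
      survAll D E i N t 0 (fun _ => []) - survAll D E i (N + D.L / 2) t 0 (fun _ => []) := by
  -- The steps after the change form exactly `w / 2` full cycles, so each pair gets the same samples
  -- wherever in the cycle the change falls.
  have hs : ∀ j, samples D E i j (D.L / 2) (t' + N') (0 + N') =
      samples D E i j (D.L / 2) (t + N) (0 + N) := by
    intro j
    rw [samples_eq_replicate D E i j P' _ (t + N) _ hP', htt',
      samples_eq_replicate D E i j P' _ (t + N) _ hP']
    by_cases hj : j = i
    · subst hj
      rw [count_order_self D j hK, count_order_self D j hK]
    · rw [D.L_half, count_order_mul_period D i hj, count_order_mul_period D i hj]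
  -- `D.L` steps are `w` full cycles, hence every window is full before the change, even for the
  -- late start.
  have hc : ∀ j, j ≠ i →
      D.w ≤ Nat.count (fun k => D.order i ((0 + k) % (K - 1)) = j) N := by
    intro j hj
    rw [← count_order_mul_period D i hj 0 D.w]
    exact Nat.count_monotone _ hL
  refine prod_sub_prod_le_prod_sub_prod _ (fun j => (D.surv_mem _ _).1) ?_ ?_ ?_ ?_ <;> intro j
  all_goals
    simp only [samples_add, hs]
    try rw [samples_eq_replicate D E i j P N t 0 ht]
    try rw [samples_eq_replicate D E i j P N' t' 0 ht']
  · exact D.surv_append_le _ _ _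
  · simpa using D.surv_replicate_antitone (P i j) [] (Nat.count_monotone _ hN)
  · exact D.surv_replicate_antitone (P i j) _ (Nat.count_monotone _ hN)
  · by_cases hj : j = i
    · subst hj
      rw [count_order_self D j hK, count_order_self D j hK]
    · exact D.surv_replicate_sub_le _ _ (hc j hj) (Nat.count_monotone _ hN)

end coupling

/-! ### Segments and weak regret -/

namespace Problem

variable (E : Problem K)

theorem ν_le_ν {a b : ℕ} (hab : a ≤ b) (hb : b ≤ E.M) : E.ν a ≤ E.ν b := by
  induction b, hab using Nat.le_induction with
  | base => exact le_rfl
  | succ b _ ih => exact (ih (by omega)).trans (E.ν_lt b (by omega)).le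

theorem one_le_ν {a : ℕ} (ha : a ≤ E.M) : 1 ≤ E.ν a :=
  E.ν_zero ▸ E.ν_le_ν (Nat.zero_le a) ha

theorem ν_le_T {a : ℕ} (ha : a ≤ E.M) : E.ν a ≤ E.T + 1 :=
  E.ν_last ▸ E.ν_le_ν ha le_rfl

theorem seg_eq {m t : ℕ} (hm : m ≤ E.M) (h1 : E.ν (m - 1) ≤ t) (h2 : t < E.ν m) :
    E.seg t = m := by
  have : ((Finset.range E.M).filter fun k => E.ν k ≤ t) = Finset.range m := by
    ext k
    simp only [Finset.mem_filter, Finset.mem_range]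
    constructor
    · rintro ⟨hk, hkt⟩
      by_contra! hmk
      exact absurd (E.ν_le_ν hmk hk.le) (by omega)
    · intro hk
      exact ⟨by omega, (E.ν_le_ν (by omega : k ≤ m - 1) (by omega)).trans h1⟩
  rw [seg, this, Finset.card_range]

theorem one_le_seg {t : ℕ} (ht : 1 ≤ t) : 1 ≤ E.seg t := by
  rw [seg, Nat.one_le_iff_ne_zero, Finset.card_ne_zero]
  exact ⟨0, by simpa [E.ν_zero] using ⟨E.one_le_M, ht⟩⟩

theorem seg_le (t : ℕ) : E.seg t ≤ E.M :=
  (Finset.card_filter_le _ _).trans (Finset.card_range _).le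

theorem gap_cw {m : ℕ} (h1 : 1 ≤ m) (hm : m ≤ E.M) : E.gap m (E.cw m) = 0 := by
  have h := E.pref_add m h1 hm (E.cw m) (E.cw m)
  unfold gap
  linarith

theorem gap_nonneg {m : ℕ} (h1 : 1 ≤ m) (hm : m ≤ E.M) (i : Fin K) : 0 ≤ E.gap m i := by
  by_cases h : i = E.cw m
  · rw [h, E.gap_cw h1 hm]
  · exact (sub_pos.2 (E.cw_beats m h1 hm i h)).le

theorem weakRegret_nonneg {t : ℕ} (ht : 1 ≤ t) (i j : Fin K) : 0 ≤ E.weakRegret t i j := by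
  have h := le_min (E.gap_nonneg (E.one_le_seg ht) (E.seg_le t) i)
    (E.gap_nonneg (E.one_le_seg ht) (E.seg_le t) j)
  exact Int.cast_nonneg (Int.ceil_nonneg h)

theorem weakRegret_le_one (t : ℕ) (i j : Fin K) : E.weakRegret t i j ≤ 1 := by
  unfold weakRegret
  have h : min (E.gap (E.seg t) i) (E.gap (E.seg t) j) ≤ ((1 : ℤ) : ℝ) := by
    refine (min_le_left _ _).trans ?_
    have := (E.pref (E.seg t) (E.cw (E.seg t)) i).2.2
    unfold gap
    push_cast
    linarith
  exact_mod_cast Int.ceil_le.2 h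

theorem weakRegret_cw {m t : ℕ} (h1 : 1 ≤ m) (hm : m ≤ E.M) (hs : E.seg t = m) (j : Fin K) :
    E.weakRegret t (E.cw m) j = 0 := by
  rw [weakRegret, hs, E.gap_cw h1 hm, min_eq_left (E.gap_nonneg h1 hm j)]
  simp

end Problem

/-! ### The black box run on its own -/

namespace Algorithm

variable (A : Algorithm K)

theorem length_of_mem_support_run (P : ℕ → Fin K → Fin K → unitInterval) (t n : ℕ)
    (h : List (Duel K)) (hh : h ∈ (A.run P t n).support) : h.length = n := by
  induction n generalizing h with
  | zero =>
    rw [run, PMF.mem_support_pure_iff] at hh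
    simp [hh]
  | succ n ih =>
    rw [run, PMF.mem_support_bind_iff] at hh
    obtain ⟨h', hh', hd⟩ := hh
    rw [PMF.mem_support_map_iff] at hd
    obtain ⟨d, _, rfl⟩ := hd
    simp [ih h' hh']

theorem run_eq_of_stationary {P : ℕ → Fin K → Fin K → unitInterval}
    {Q : Fin K → Fin K → unitInterval} {t n : ℕ} (h : ∀ k < n, P (t + k) = Q) :
    A.run P t n = A.run (fun _ => Q) 1 n := by
  induction n with
  | zero => rfl
  | succ n ih => rw [run, run, ih fun k hk => h k (by omega), h n (by omega)]

/-- The sum of `g` over the rounds that correspond to the history of a running phase begun at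
time `t`. -/
def histSum (g : Round K → ℝ≥0∞) (t : ℕ) : List (Duel K) → ℝ≥0∞
  | [] => 0
  | d :: h => g ⟨t + h.length, d.1, d.2.1, none, false⟩ + histSum g t h

theorem histSum_zero (t : ℕ) : histSum (K := K) (fun _ => 0) t = fun _ => 0 := by
  funext h
  induction h with
  | nil => rfl
  | cons d h ih => simp [histSum, ih]

end Algorithm

/-! ### The law of DETECT: named arm and alarm time -/

section runs

variable (D : Params K) (A : Algorithm K) (E : Problem K)

theorem ev_runFrom_succ (n t : ℕ) (s : State K) (f : List (Round K) → ℝ≥0∞) :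
    ev (runFrom D A E (n + 1) t s) f =
      ev (step D A (E.prefAt t) t s) fun r =>
        ev (runFrom D A E n (t + 1) r.2) fun ω => f (r.1 :: ω) := by
  simp only [runFrom, ev_bind, ev_map]

/-- The additivity of `f` along running rounds covers two uses: `f` the regret, and `f` the
indicator of an event that such rounds do not affect, with `g = 0`. -/
theorem ev_runFrom_init {g : Round K → ℝ≥0∞} {f : List (Round K) → ℝ≥0∞}
    (hf : ∀ r ω, r.cand = none → r.alarm = false → f (r :: ω) = g r + f ω) (k n t : ℕ)
    (hk : k ≤ D.Ttil) :
    ev (runFrom D A E (k + n) t State.init) f =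
      ev (A.run E.prefAt t k) fun h =>
        Algorithm.histSum g t h + ev (runFrom D A E n (t + k) (State.running h)) f := by
  induction k generalizing n with
  | zero => simp [Algorithm.run, ev_pure, Algorithm.histSum, State.init]
  | succ k ih =>
    rw [show k + 1 + n = k + (n + 1) by ring, ih (n + 1) (by omega), Algorithm.run, ev_bind]
    refine ev_congr _ fun h hh => ?_
    have hl := A.length_of_mem_support_run _ _ _ _ hh
    rw [ev_map, ev_runFrom_succ, step, if_pos (by omega), ev_map]
    simp only [hf, ev_add, ev_const, Algorithm.histSum, hl, add_assoc]
    ring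

theorem runFrom_running_of_length {h : List (Duel K)} (hh : h.length = D.Ttil) (n t : ℕ) :
    runFrom D A E (n + 1) t (State.running h) =
      (A.suspect h).bind fun i =>
        runFrom D A E (n + 1) t (State.detecting i 0 fun _ => []) := by
  simp only [runFrom, step, hh, lt_irrefl, if_false, PMF.bind_bind]

theorem ev_runFrom_init_eq {g : Round K → ℝ≥0∞} {f : List (Round K) → ℝ≥0∞}
    (hf : ∀ r ω, r.cand = none → r.alarm = false → f (r :: ω) = g r + f ω) (n t : ℕ) :
    ev (runFrom D A E (D.Ttil + (n + 1)) t State.init) f =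
      ev (A.run E.prefAt t D.Ttil) (Algorithm.histSum g t) +
        ev ((A.run E.prefAt t D.Ttil).bind A.suspect) fun i =>
          ev (runFrom D A E (n + 1) (t + D.Ttil) (State.detecting i 0 fun _ => [])) f := by
  rw [ev_runFrom_init D A E hf _ _ _ le_rfl, ev_add, ev_bind]
  congr 1
  refine ev_congr _ fun h hh => ?_
  rw [runFrom_running_of_length D A E (A.length_of_mem_support_run _ _ _ _ hh), ev_bind]

open Classical in
theorem ev_detectStep (P : Fin K → Fin K → unitInterval) (t : ℕ) (i : Fin K) (d : ℕ)
    (obs : Fin K → List Bool) (j : Fin K) (hj : D.order i (d % (K - 1)) = j)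
    (f : Round K × State K → ℝ≥0∞) :
    ev (detectStep D P t i d obs) f =
      ENNReal.ofReal (P i j) * (if D.triggers (true :: obs j) then
        f (⟨t, i, j, some i, true⟩, State.init) else f (⟨t, i, j, some i, false⟩,
          State.detecting i (d + 1) (Function.update obs j (true :: obs j)))) +
      ENNReal.ofReal (1 - P i j) * (if D.triggers (false :: obs j) then
        f (⟨t, i, j, some i, true⟩, State.init) else f (⟨t, i, j, some i, false⟩,
          State.detecting i (d + 1) (Function.update obs j (false :: obs j)))) := by
  subst hj
  simp only [detectStep, ev_map, ev_duelOutcome, Function.update_self, apply_ite f]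

theorem time_of_mem_support_step {P : Fin K → Fin K → unitInterval} {t : ℕ} {s : State K}
    {r : Round K × State K} (hr : r ∈ (step D A P t s).support) : r.1.time = t := by
  have key : ∀ i d obs, r ∈ (detectStep D P t i d obs).support → r.1.time = t := by
    intro i d obs h
    rw [detectStep, PMF.mem_support_map_iff] at h
    obtain ⟨x, _, rfl⟩ := h
    dsimp only
    split_ifs <;> rfl
  cases s with
  | running h =>
    rw [step] at hr
    split_ifs at hr
    · rw [PMF.mem_support_map_iff] at hr
      obtain ⟨x, _, rfl⟩ := hr
      rfl
    · rw [PMF.mem_support_bind_iff] at hr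
      obtain ⟨i, _, hi⟩ := hr
      exact key _ _ _ hi
  | detecting i d obs => exact key _ _ _ hr

theorem le_time_of_mem_support_runFrom {n t : ℕ} {s : State K} {ω : List (Round K)}
    (hω : ω ∈ (runFrom D A E n t s).support) : ∀ r ∈ ω, t ≤ r.time := by
  induction n generalizing t s ω with
  | zero =>
    rw [runFrom, PMF.mem_support_pure_iff] at hω
    simp [hω]
  | succ n ih =>
    rw [runFrom, PMF.mem_support_bind_iff] at hω
    obtain ⟨r, hr, hω⟩ := hω
    rw [PMF.mem_support_map_iff] at hω
    obtain ⟨ω', hω', rfl⟩ := hω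
    intro r' hr'
    rcases List.mem_cons.1 hr' with rfl | hr'
    · exact (time_of_mem_support_step D A hr).ge
    · exact (Nat.le_succ t).trans (ih hω' r' hr')

theorem le_alarmTime {t : ℕ} {ω : List (Round K)} (h : ∀ r ∈ ω, t ≤ r.time) :
    (t : ℕ∞) ≤ alarmTime ω := by
  induction ω with
  | nil => exact le_top
  | cons r ω ih =>
    rw [alarmTime]
    split_ifs
    · exact_mod_cast h r List.mem_cons_self
    · exact ih fun r' hr' => h r' (List.mem_cons_of_mem _ hr')

theorem firstSuspect_of_mem_support {n t d : ℕ} {i : Fin K} {obs : Fin K → List Bool}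
    {ω : List (Round K)}
    (hω : ω ∈ (runFrom D A E (n + 1) t (State.detecting i d obs)).support) :
    firstSuspect ω = some i := by
  rw [runFrom, PMF.mem_support_bind_iff] at hω
  obtain ⟨r, hr, hω⟩ := hω
  rw [PMF.mem_support_map_iff] at hω
  obtain ⟨ω', _, rfl⟩ := hω
  rw [step, detectStep, PMF.mem_support_map_iff] at hr
  obtain ⟨x, _, rfl⟩ := hr
  dsimp only
  split_ifs <;> rfl

/-- The event says that the first `k` steps raise no alarm, so peeling off one step reproduces the
recursion `survAll_succ`. -/
theorem prob_le_alarmTime_detecting {k n t d : ℕ} (hk : k ≤ n) (i : Fin K)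
    (obs : Fin K → List Bool) :
    prob (runFrom D A E n t (State.detecting i d obs))
      {ω | ((t + k : ℕ) : ℕ∞) ≤ alarmTime ω} = ENNReal.ofReal (survAll D E i k t d obs) := by
  induction k generalizing n t d obs with
  | zero =>
    rw [survAll_zero, ENNReal.ofReal_one, prob, ← ev_const (runFrom D A E n t (State.detecting i d obs)) 1]
    refine ev_congr _ fun ω hω => ?_
    rw [Set.indicator_of_mem]
    · rfl
    · exact le_alarmTime (le_time_of_mem_support_runFrom D A E hω)
  | succ k ih =>
    obtain ⟨n, rfl⟩ : ∃ n', n = n' + 1 := ⟨n - 1, by omega⟩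
    have h0 : (0 : ℝ) ≤ E.prefAt t i (D.order i (d % (K - 1))) := (E.prefAt t i _).2.1
    have h1 : (0 : ℝ) ≤ 1 - E.prefAt t i (D.order i (d % (K - 1))) :=
      sub_nonneg.2 (E.prefAt t i _).2.2
    have hno : ∀ x, ev (runFrom D A E n (t + 1) (State.detecting i (d + 1)
        (Function.update obs (D.order i (d % (K - 1))) (x :: obs (D.order i (d % (K - 1)))))))
          (fun ω => Set.indicator {ω | ((t + (k + 1) : ℕ) : ℕ∞) ≤ alarmTime ω} 1
            (⟨t, i, D.order i (d % (K - 1)), some i, false⟩ :: ω)) =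
        ENNReal.ofReal (survAll D E i k (t + 1) (d + 1)
          (Function.update obs (D.order i (d % (K - 1))) (x :: obs (D.order i (d % (K - 1)))))) := by
      intro x
      rw [← ih (n := n) (by omega), show t + 1 + k = t + (k + 1) by ring]
      rfl
    have hyes : (fun ω => Set.indicator {ω | ((t + (k + 1) : ℕ) : ℕ∞) ≤ alarmTime ω}
        (1 : List (Round K) → ℝ≥0∞)
            (⟨t, i, D.order i (d % (K - 1)), some i, true⟩ :: ω)) = fun _ => 0 := by
      funext ω
      rw [Set.indicator_of_notMem]
      simp only [alarmTime, Set.mem_ofPred_eq, if_true, Nat.cast_le]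
      omega
    rw [survAll_succ D E i k t d obs _ rfl, prob, ev_runFrom_succ, step,
      ev_detectStep D _ t i d obs _ rfl]
    dsimp only
    rw [hno, hno, hyes, ev_const]
    rw [ENNReal.ofReal_add, ENNReal.ofReal_mul h0, ENNReal.ofReal_mul h1]
    · congr 2 <;> split_ifs <;> simp
    · refine mul_nonneg h0 ?_
      split_ifs
      · exact le_rfl
      · exact (survAll_mem _ _ _ _ _ _ _).1
    · refine mul_nonneg h1 ?_
      split_ifs
      · exact le_rfl
      · exact (survAll_mem _ _ _ _ _ _ _).1

theorem prob_correctEvent_inter {S : Set (List (Round K))}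
    (hS : ∀ r ω, r.alarm = false → (r :: ω ∈ S ↔ ω ∈ S)) (m n t : ℕ) :
    prob (runFrom D A E (D.Ttil + (n + 1)) t State.init) (correctEvent E m ∩ S) =
      ((A.run E.prefAt t D.Ttil).bind A.suspect) (E.cw m) *
        prob (runFrom D A E (n + 1) (t + D.Ttil) (State.detecting (E.cw m) 0 fun _ => [])) S := by
  rw [prob, ev_runFrom_init_eq D A E (g := fun _ => 0)]
  · simp only [Algorithm.histSum_zero, ev_const, zero_add]
    rw [ev, tsum_eq_single (E.cw m)]
    · congr 1
      refine ev_congr _ fun ω hω => ?_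
      rw [Set.inter_indicator_one, Pi.mul_apply, Set.indicator_of_mem (s := correctEvent E m)]
      · simp
      · exact firstSuspect_of_mem_support D A E hω
    · intro i hi
      refine mul_eq_zero_of_right _
        ((ev_congr _ (g := fun _ => 0) fun ω hω => ?_).trans (ev_const _ _))
      rw [Set.indicator_of_notMem]
      rintro ⟨h, -⟩
      have h' : firstSuspect ω = some (E.cw m) := h
      rw [firstSuspect_of_mem_support D A E hω, Option.some_inj] at h'
      exact hi h'
  · intro r ω hr ha
    have e : r :: ω ∈ correctEvent E m ∩ S ↔ ω ∈ correctEvent E m ∩ S :=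
      and_congr (by simp [correctEvent, firstSuspect, hr]) (hS r ω ha)
    by_cases h : ω ∈ correctEvent E m ∩ S
    · rw [Set.indicator_of_mem h, Set.indicator_of_mem (e.2 h)]
      simp
    · rw [Set.indicator_of_notMem h, Set.indicator_of_notMem fun h' => h (e.1 h')]
      simp

theorem prob_correctEvent (m n t : ℕ) :
    prob (runFrom D A E (D.Ttil + (n + 1)) t State.init) (correctEvent E m) =
      ((A.run E.prefAt t D.Ttil).bind A.suspect) (E.cw m) := by
  have h := prob_correctEvent_inter D A E (S := Set.univ) (by simp) m n t
  rw [Set.inter_univ] at h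
  rw [h, prob, Set.indicator_univ]
  exact (congrArg _ (ev_const _ 1)).trans (mul_one _)

theorem prob_correctEvent_inter_le_alarmTime {m k n t : ℕ} (hk : k ≤ n + 1) :
    prob (runFrom D A E (D.Ttil + (n + 1)) t State.init)
      (correctEvent E m ∩ {ω | ((t + D.Ttil + k : ℕ) : ℕ∞) ≤ alarmTime ω}) =
      ((A.run E.prefAt t D.Ttil).bind A.suspect) (E.cw m) *
        ENNReal.ofReal (survAll D E (E.cw m) k (t + D.Ttil) 0 fun _ => []) := by
  rw [← prob_le_alarmTime_detecting D A E hk]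
  refine prob_correctEvent_inter D A E (fun r ω ha => ?_) m n t
  simp only [Set.mem_ofPred_eq, alarmTime, ha, Bool.false_eq_true, if_false]

theorem prob_inter_add_prob_inter_compl {α : Type*} (μ : PMF α) (B S : Set α) :
    prob μ (B ∩ S) + prob μ (B ∩ Sᶜ) = prob μ B := by
  rw [prob, prob, prob, ← ev_add]
  refine ev_congr _ fun a _ => ?_
  by_cases h1 : a ∈ B <;> by_cases h2 : a ∈ S <;> simp [h1, h2]

end runs

/-! ### Regret in `ℝ≥0∞` -/

/-- The regret of a round, as an extended nonnegative number. -/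
def roundRegret (E : Problem K) (r : Round K) : ℝ≥0∞ :=
  ENNReal.ofReal (E.weakRegret r.time r.fst r.snd)

/-- The regret of a sequence of rounds, as an extended nonnegative number. -/
def regretE (E : Problem K) (ω : List (Round K)) : ℝ≥0∞ := (ω.map (roundRegret E)).sum

theorem regretE_cons (E : Problem K) (r : Round K) (ω : List (Round K)) :
    regretE E (r :: ω) = roundRegret E r + regretE E ω := by
  simp [regretE]

theorem roundRegret_le_one (E : Problem K) (r : Round K) : roundRegret E r ≤ 1 := by
  rw [roundRegret, ← ENNReal.ofReal_one]
  exact ENNReal.ofReal_le_ofReal (E.weakRegret_le_one _ _ _)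

theorem ofReal_totalRegret (E : Problem K) {ω : List (Round K)} (h : ∀ r ∈ ω, 1 ≤ r.time) :
    0 ≤ totalRegret E ω ∧ ENNReal.ofReal (totalRegret E ω) = regretE E ω := by
  induction ω with
  | nil => simp [totalRegret, regretE]
  | cons r ω ih =>
    obtain ⟨h1, h2⟩ := ih fun r' hr' => h r' (List.mem_cons_of_mem _ hr')
    have h0 := E.weakRegret_nonneg (h r List.mem_cons_self) r.fst r.snd
    have e : totalRegret E (r :: ω) = E.weakRegret r.time r.fst r.snd + totalRegret E ω := by
      simp [totalRegret]
    rw [e, ENNReal.ofReal_add h0 h1, h2, regretE_cons, roundRegret]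
    exact ⟨add_nonneg h0 h1, rfl⟩

namespace Algorithm

variable (A : Algorithm K) (E : Problem K)

theorem ofReal_histRegret {t : ℕ} (ht : 1 ≤ t) (h : List (Duel K)) :
    0 ≤ histRegret E t h ∧
      ENNReal.ofReal (histRegret E t h) = histSum (roundRegret E) t h := by
  induction h with
  | nil => simp [histRegret, histSum]
  | cons d h ih =>
    have h0 := E.weakRegret_nonneg (ht.trans (Nat.le_add_right t h.length)) d.1 d.2.1
    rw [histRegret, ENNReal.ofReal_add h0 ih.1, ih.2, histSum, roundRegret]
    exact ⟨add_nonneg h0 ih.1, rfl⟩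

theorem histSum_roundRegret_le (t : ℕ) (h : List (Duel K)) :
    histSum (roundRegret E) t h ≤ h.length := by
  induction h with
  | nil => simp [histSum]
  | cons d h ih =>
    rw [histSum, List.length_cons, Nat.cast_succ, add_comm]
    exact add_le_add ih (roundRegret_le_one E _)

theorem histSum_roundRegret_congr {t t' : ℕ} (h : List (Duel K))
    (hs : ∀ k < h.length, E.seg (t + k) = E.seg (t' + k)) :
    histSum (roundRegret E) t h = histSum (roundRegret E) t' h := by
  induction h with
  | nil => rfl
  | cons d h ih =>
    rw [histSum, histSum, ih fun k hk => hs k (hk.trans (by simp)), roundRegret, roundRegret,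
      Problem.weakRegret, Problem.weakRegret, hs h.length (by simp)]

theorem ofReal_expRegret {t : ℕ} (ht : 1 ≤ t) (n : ℕ) :
    ENNReal.ofReal (A.expRegret E t n) =
      ev (A.run E.prefAt t n) (histSum (roundRegret E) t) := by
  rw [expRegret, expect_eq_toReal_ev _ fun h _ => (ofReal_histRegret E ht h).1]
  simp only [(ofReal_histRegret E ht _).2]
  refine ENNReal.ofReal_toReal (ne_top_of_le_ne_top (ENNReal.natCast_ne_top n) ?_)
  rw [← ev_const (A.run E.prefAt t n) (n : ℝ≥0∞)]
  refine ev_mono _ fun h hh => ?_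
  rw [← A.length_of_mem_support_run _ _ _ _ hh]
  exact histSum_roundRegret_le E t h

theorem expRegret_nonneg {t : ℕ} (ht : 1 ≤ t) (n : ℕ) : 0 ≤ A.expRegret E t n := by
  rw [expRegret, expect_eq_toReal_ev _ fun h _ => (ofReal_histRegret E ht h).1]
  exact ENNReal.toReal_nonneg

end Algorithm

/-! ### Expected regret of a detection phase -/

theorem two_point_le {p a b : ℝ} (hp0 : 0 ≤ p) (hp1 : p ≤ 1) (ha : 0 ≤ a) (hb : 0 ≤ b)
    {x y : ℝ≥0∞} (hx : x ≤ ENNReal.ofReal a) (hy : y ≤ ENNReal.ofReal b) :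
    ENNReal.ofReal p * x + ENNReal.ofReal (1 - p) * y ≤
      ENNReal.ofReal (p * a + (1 - p) * b) := by
  have h1 := sub_nonneg.2 hp1
  rw [ENNReal.ofReal_add (mul_nonneg hp0 ha) (mul_nonneg h1 hb), ENNReal.ofReal_mul hp0,
    ENNReal.ofReal_mul h1]
  gcongr

section value

variable (D : Params K) (A : Algorithm K) (E : Problem K)

theorem ev_regretE_succ (n t : ℕ) (s : State K) :
    ev (runFrom D A E (n + 1) t s) (regretE E) =
      ev (step D A (E.prefAt t) t s) fun r =>
        roundRegret E r.1 + ev (runFrom D A E n (t + 1) r.2) (regretE E) := by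
  simp only [ev_runFrom_succ, regretE_cons, ev_add, ev_const]

theorem ev_regretE_le (n t : ℕ) (s : State K) :
    ev (runFrom D A E n t s) (regretE E) ≤ n := by
  induction n generalizing t s with
  | zero => simp [runFrom, ev_pure, regretE]
  | succ n ih =>
    rw [ev_regretE_succ, ← ev_const (step D A (E.prefAt t) t s) ((n + 1 : ℕ) : ℝ≥0∞)]
    refine ev_mono _ fun r _ => ?_
    rw [Nat.cast_succ, add_comm]
    exact add_le_add (ih _ _) (roundRegret_le_one E _)

theorem ev_regretE_le_ofReal {n : ℕ} {x : ℝ} (hn : (n : ℝ) ≤ x) (t : ℕ) (s : State K) :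
    ev (runFrom D A E n t s) (regretE E) ≤ ENNReal.ofReal x := by
  refine (ev_regretE_le D A E n t s).trans ?_
  rw [← ENNReal.ofReal_natCast]
  exact ENNReal.ofReal_le_ofReal hn

open Classical in
/-- One detection step, when a bound for the value after an alarm and a bound for the value
without an alarm are known. -/
theorem ev_regretE_detecting_le {n t d : ℕ} {i : Fin K} {obs : Fin K → List Bool} (j : Fin K)
    (hj : D.order i (d % (K - 1)) = j) {a r : ℝ} {b : Bool → ℝ} (ha : 0 ≤ a) (hb : ∀ x, 0 ≤ b x)
    (hr : 0 ≤ r) (hreg : ∀ c al, roundRegret E ⟨t, i, j, c, al⟩ ≤ ENNReal.ofReal r)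
    (halarm : ev (runFrom D A E n (t + 1) State.init) (regretE E) ≤ ENNReal.ofReal a)
    (hno : ∀ x, ev (runFrom D A E n (t + 1) (State.detecting i (d + 1)
      (Function.update obs j (x :: obs j)))) (regretE E) ≤ ENNReal.ofReal (b x)) :
    ev (runFrom D A E (n + 1) t (State.detecting i d obs)) (regretE E) ≤
      ENNReal.ofReal (E.prefAt t i j * (if D.triggers (true :: obs j) then r + a else r + b true) +
        (1 - E.prefAt t i j) * (if D.triggers (false :: obs j) then r + a else r + b false)) := by
  rw [ev_regretE_succ, step, ev_detectStep D _ t i d obs j hj]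
  refine two_point_le (E.prefAt t i j).2.1 (E.prefAt t i j).2.2 ?_ ?_ ?_ ?_ <;> split_ifs
  · positivity
  · exact add_nonneg hr (hb _)
  · positivity
  · exact add_nonneg hr (hb _)
  all_goals
    rw [ENNReal.ofReal_add hr (by first | exact ha | exact hb _)]
    first | exact add_le_add (hreg _ _) halarm | exact add_le_add (hreg _ _) (hno _)

/-- If the value after a restart in the next `k` steps is at most `B`, then the value of a
detection phase is at most `k + B`, up to the event that there is no alarm in these steps. -/
theorem ev_regretE_detecting_le_of_restart {B : ℝ} (hB : 0 ≤ B) {k n t d : ℕ} (i : Fin K)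
    (obs : Fin K → List Bool) (hkn : k ≤ n) (hn : n ≤ E.T)
    (hrestart : ∀ l, 1 ≤ l → l ≤ k →
      ev (runFrom D A E (n - l) (t + l) State.init) (regretE E) ≤ ENNReal.ofReal B) :
    ev (runFrom D A E n t (State.detecting i d obs)) (regretE E) ≤
      ENNReal.ofReal (k + B + E.T * survAll D E i k t d obs) := by
  induction k generalizing n t d obs with
  | zero =>
    have hn' : (n : ℝ) ≤ E.T := by exact_mod_cast hn
    refine ev_regretE_le_ofReal D A E ?_ t _
    rw [survAll_zero, Nat.cast_zero]
    linarith
  | succ k ih =>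
    obtain ⟨n, rfl⟩ : ∃ n', n = n' + 1 := ⟨n - 1, by omega⟩
    have hS : ∀ x, 0 ≤ survAll D E i k (t + 1) (d + 1)
        (Function.update obs (D.order i (d % (K - 1))) (x :: obs (D.order i (d % (K - 1))))) :=
      fun x => (survAll_mem _ _ _ _ _ _ _).1
    refine (ev_regretE_detecting_le D A E _ rfl (a := k + B) (r := 1)
      (b := fun x => k + B + E.T * survAll D E i k (t + 1) (d + 1) _) (by positivity)
      (fun x => add_nonneg (by positivity) (mul_nonneg (by positivity) (hS x))) zero_le_one
      (fun _ _ => by simpa using roundRegret_le_one E _) ?_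
      fun x => ih _ (by omega) (by omega) fun l h1 h2 => ?_).trans
      (ENNReal.ofReal_le_ofReal ?_)
    · refine (hrestart 1 le_rfl (by omega)).trans (ENNReal.ofReal_le_ofReal ?_)
      linarith [(Nat.cast_nonneg k : (0 : ℝ) ≤ k)]
    · have := hrestart (l + 1) (by omega) (by omega)
      rwa [show n + 1 - (l + 1) = n - l by omega, show t + (l + 1) = t + 1 + l by ring] at this
    · rw [survAll_succ D E i k t d obs _ rfl]
      push_cast
      refine le_of_eq ?_
      split_ifs <;> ring

/-- The value of a detection phase in which the suspected arm is the Condorcet winner of the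
current segment, which lasts for `N` more steps: up to the event of an alarm in these steps, only
the regret from the later steps counts. -/
theorem ev_regretE_detecting_le_of_no_regret {C ε : ℝ} (hC : 0 ≤ C) (hε : 0 ≤ ε)
    {N n t d H : ℕ} (i : Fin K) (obs : Fin K → List Bool) (hNn : N ≤ n) (hn : n ≤ E.T)
    (hi : ∀ k < N, ∀ j, E.weakRegret (t + k) i j = 0)
    (hlater : ∀ d obs, ev (runFrom D A E (n - N) (t + N) (State.detecting i d obs)) (regretE E) ≤
      ENNReal.ofReal (C + E.T * (ε * survAll D E i H (t + N) d obs))) :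
    ev (runFrom D A E n t (State.detecting i d obs)) (regretE E) ≤
      ENNReal.ofReal (C + E.T * (1 - survAll D E i N t d obs +
        ε * survAll D E i (N + H) t d obs)) := by
  induction N generalizing n t d obs with
  | zero => simpa [survAll_zero] using hlater d obs
  | succ N ih =>
    obtain ⟨n, rfl⟩ : ∃ n', n = n' + 1 := ⟨n - 1, by omega⟩
    have hn' : (n : ℝ) ≤ E.T := by exact_mod_cast (by omega : n ≤ E.T)
    have hb : ∀ x, 0 ≤ C + E.T * (1 - survAll D E i N (t + 1) (d + 1)
        (Function.update obs (D.order i (d % (K - 1))) (x :: obs (D.order i (d % (K - 1))))) +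
        ε * survAll D E i (N + H) (t + 1) (d + 1)
        (Function.update obs (D.order i (d % (K - 1))) (x :: obs (D.order i (d % (K - 1)))))) := by
      intro x
      have h1 := sub_nonneg.2 (survAll_mem D E i N (t + 1) (d + 1) (Function.update obs
        (D.order i (d % (K - 1))) (x :: obs (D.order i (d % (K - 1)))))).2
      have h2 := (survAll_mem D E i (N + H) (t + 1) (d + 1) (Function.update obs
        (D.order i (d % (K - 1))) (x :: obs (D.order i (d % (K - 1)))))).1
      positivity
    -- An alarm before the segment ends is charged the crude bound `T`. Keeping `C` in the charge
    -- makes the bound affine in the survival probabilities, so the final comparison is an equality.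
    refine (ev_regretE_detecting_le D A E _ rfl (a := C + E.T) (r := 0)
      (b := fun x => C + E.T * (1 - survAll D E i N (t + 1) (d + 1)
        (Function.update obs (D.order i (d % (K - 1))) (x :: obs (D.order i (d % (K - 1))))) +
        ε * survAll D E i (N + H) (t + 1) (d + 1)
        (Function.update obs (D.order i (d % (K - 1))) (x :: obs (D.order i (d % (K - 1)))))))
      (by positivity) hb le_rfl (fun _ _ => ?_) ?_
      fun x => ih _ (by omega) (by omega) (fun k hk j => ?_) fun d obs => ?_).trans
      (ENNReal.ofReal_le_ofReal ?_)
    · have := hi 0 (by omega) (D.order i (d % (K - 1)))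
      simp only [add_zero] at this
      rw [roundRegret, this]
    · exact ev_regretE_le_ofReal D A E (by linarith) _ _
    · have := hi (k + 1) (by omega) j
      rwa [show t + (k + 1) = t + 1 + k by ring] at this
    · have := hlater d obs
      rwa [show n + 1 - (N + 1) = n - N by omega,
        show t + (N + 1) = t + 1 + N by ring] at this
    · rw [show N + 1 + H = N + H + 1 by ring, survAll_succ D E i N t d obs _ rfl,
        survAll_succ D E i (N + H) t d obs _ rfl]
      refine le_of_eq ?_
      split_ifs <;> ring

end value

/-- The first two bounds give `c * (U - V) ≥ (1 - q) * (1 - p) * c ≥ (1 - q) * (1 - p) * pT`; the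
remaining product `q * (1 - p) * pT` is at most `q`. -/
theorem one_sub_mul_le {pT c p q U V g : ℝ} (hpT : pT ≤ c) (hc0 : 0 ≤ c) (hc1 : c ≤ 1)
    (hp0 : 0 ≤ p) (hp1 : p ≤ 1) (hq0 : 0 ≤ q) (hq1 : q ≤ 1) (hU : c * (1 - U) ≤ p * c)
    (hV : c * V ≤ q * (c * U)) (hg : U - V ≤ g) : 1 - c * g ≤ 1 - pT + p * pT + q := by
  have h1 : c * (U - V) ≤ c * g := mul_le_mul_of_nonneg_left hg hc0
  have h2 : (1 - q) * (c * (1 - U)) ≤ (1 - q) * (p * c) :=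
    mul_le_mul_of_nonneg_left hU (sub_nonneg.2 hq1)
  have h3 : (1 - q) * (1 - p) * pT ≤ (1 - q) * (1 - p) * c :=
    mul_le_mul_of_nonneg_left hpT (mul_nonneg (sub_nonneg.2 hq1) (sub_nonneg.2 hp1))
  have h4 : (1 - p) * pT ≤ 1 := by nlinarith
  nlinarith [mul_le_mul_of_nonneg_left h4 hq0]

/-! ### Recursion over the segments -/

section main

variable (D : Params K) (A : Algorithm K) (E : Problem K)

theorem identProb_mem (P : Fin K → Fin K → unitInterval) (n : ℕ) (i : Fin K) :
    0 ≤ A.identProb P n i ∧ A.identProb P n i ≤ 1 := by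
  refine ⟨ENNReal.toReal_nonneg, ?_⟩
  rw [Algorithm.identProb, ← ENNReal.toReal_one]
  exact ENNReal.toReal_mono ENNReal.one_ne_top (PMF.coe_le_one _ _)

/-- The value of DETECT started in segment `m`, from a bound for the value of the detection phase
with the correct arm. -/
theorem ev_regretE_init_le {m t : ℕ} (h1 : 1 ≤ m) (hm : m ≤ E.M) (ht : E.ν (m - 1) ≤ t)
    (htν : t + D.Ttil < E.ν m) {C g : ℝ} (hC : 0 ≤ C) (hg : g ≤ 1)
    (hdet : ev (runFrom D A E (E.T + 1 - (t + D.Ttil)) (t + D.Ttil)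
      (State.detecting (E.cw m) 0 fun _ => [])) (regretE E) ≤
        ENNReal.ofReal (C + E.T * (1 - g))) :
    ev (runFrom D A E (E.T + 1 - t) t State.init) (regretE E) ≤
      ENNReal.ofReal (A.expRegret E (E.ν (m - 1)) D.Ttil +
        (C + E.T * (1 - A.identProb (E.pref m) D.Ttil (E.cw m) * g))) := by
  classical
  have hν1 : 1 ≤ E.ν (m - 1) := E.one_le_ν (by omega)
  have hνT := E.ν_le_T hm
  have hseg : ∀ u, E.ν (m - 1) ≤ u → u < E.ν m → E.seg u = m := fun u => E.seg_eq hm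
  have hrun : ∀ u, E.ν (m - 1) ≤ u → u + D.Ttil < E.ν m →
      A.run E.prefAt u D.Ttil = A.run (fun _ => E.pref m) 1 D.Ttil := by
    intro u hu1 hu2
    refine A.run_eq_of_stationary fun k hk => ?_
    rw [Problem.prefAt, hseg _ (by omega) (by omega)]
  obtain ⟨n, hn⟩ : ∃ n, E.T + 1 - (t + D.Ttil) = n + 1 := ⟨E.T - (t + D.Ttil), by omega⟩
  rw [hn] at hdet
  rw [show E.T + 1 - t = D.Ttil + (n + 1) by omega,
    ev_runFrom_init_eq D A E (g := roundRegret E) fun r ω _ _ => regretE_cons E r ω,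
    -- Running phases started at `t` and at `ν (m-1)` stay inside segment `m`, so they have the same
    -- law and the same expected regret.
    hrun t ht htν, ← hrun (E.ν (m - 1)) le_rfl (by omega)]
  have hreg : ev (A.run E.prefAt (E.ν (m - 1)) D.Ttil)
      (Algorithm.histSum (roundRegret E) t) =
      ENNReal.ofReal (A.expRegret E (E.ν (m - 1)) D.Ttil) := by
    rw [A.ofReal_expRegret E hν1]
    refine ev_congr _ fun h hh => Algorithm.histSum_roundRegret_congr E h fun k hk => ?_
    rw [A.length_of_mem_support_run _ _ _ _ hh] at hk
    rw [hseg _ (by omega) (by omega), hseg _ (by omega) (by omega)]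
  set μ := (A.run E.prefAt (E.ν (m - 1)) D.Ttil).bind A.suspect with hμ
  have hident : A.identProb (E.pref m) D.Ttil (E.cw m) = (μ (E.cw m)).toReal := by
    rw [hμ, hrun (E.ν (m - 1)) le_rfl (by omega), Algorithm.identProb]
  have hsum : ∑ i, (μ i).toReal * (C + E.T * (1 - if i = E.cw m then g else 0)) =
      C + E.T * (1 - (μ (E.cw m)).toReal * g) := by
    have e : ∀ i, (μ i).toReal * (C + E.T * (1 - if i = E.cw m then g else 0)) =
        (μ i).toReal * (C + E.T) - E.T * (if i = E.cw m then (μ i).toReal * g else 0) := by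
      intro i
      split_ifs <;> ring
    simp only [e, Finset.sum_sub_distrib, ← Finset.sum_mul, ← Finset.mul_sum,
      sum_toReal_eq_one, Finset.sum_ite_eq', Finset.mem_univ, if_true]
    ring
  have hnonneg : ∀ i, 0 ≤ C + E.T * (1 - if i = E.cw m then g else 0) := by
    intro i
    have : 0 ≤ 1 - if i = E.cw m then g else 0 := by split_ifs <;> linarith
    positivity
  rw [hreg, hident, ← hsum, ENNReal.ofReal_add (A.expRegret_nonneg E hν1 _)
    (Finset.sum_nonneg fun i _ => mul_nonneg ENNReal.toReal_nonneg (hnonneg i))]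
  refine add_le_add le_rfl (ev_le_ofReal_sum μ hnonneg fun i => ?_)
  by_cases hi : i = E.cw m
  · rw [if_pos hi, hi]
    exact hdet
  · rw [if_neg hi]
    refine ev_regretE_le_ofReal D A E ?_ _ _
    have : ((n + 1 : ℕ) : ℝ) ≤ E.T := by exact_mod_cast (by omega : n + 1 ≤ E.T)
    linarith

/-- The probabilities of the events of the hypotheses, for DETECT started with segment `m`. -/
theorem toReal_prob_detect {m k : ℕ} (hm : m ≤ E.M)
    (hT : E.ν (m - 1) + D.Ttil < E.ν m) (hk : E.ν (m - 1) + D.Ttil + k ≤ E.T + 1) :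
    (prob (detect D A E (E.ν (m - 1))) (correctEvent E m)).toReal =
        A.identProb (E.pref m) D.Ttil (E.cw m) ∧
      (prob (detect D A E (E.ν (m - 1))) (correctEvent E m ∩
        {ω | ((E.ν (m - 1) + D.Ttil + k : ℕ) : ℕ∞) ≤ alarmTime ω})).toReal =
        A.identProb (E.pref m) D.Ttil (E.cw m) *
          survAll D E (E.cw m) k (E.ν (m - 1) + D.Ttil) 0 fun _ => [] := by
  have hνT := E.ν_le_T hm
  obtain ⟨n, hn⟩ : ∃ n, E.T + 1 - E.ν (m - 1) = D.Ttil + (n + 1) :=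
    ⟨E.T - (E.ν (m - 1) + D.Ttil), by omega⟩
  have hrun : A.run E.prefAt (E.ν (m - 1)) D.Ttil = A.run (fun _ => E.pref m) 1 D.Ttil := by
    refine A.run_eq_of_stationary fun k hk => ?_
    rw [Problem.prefAt, E.seg_eq hm (by omega) (by omega)]
  rw [detect, hn, prob_correctEvent, prob_correctEvent_inter_le_alarmTime D A E (by omega), hrun,
    ENNReal.toReal_mul, ENNReal.toReal_ofReal (survAll_mem _ _ _ _ _ _ _).1]
  exact ⟨rfl, rfl⟩

theorem identProb_mul_one_sub_survAll_le {m : ℕ} (hm : m ≤ E.M)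
    (hT : E.ν (m - 1) + D.Ttil < E.ν m) {p : ℝ}
    (hp : condProb (detect D A E (E.ν (m - 1)))
        {ω | alarmTime ω < (E.ν m : ℕ∞)} (correctEvent E m) ≤ p) :
    A.identProb (E.pref m) D.Ttil (E.cw m) *
      (1 - survAll D E (E.cw m) (E.ν m - (E.ν (m - 1) + D.Ttil)) (E.ν (m - 1) + D.Ttil) 0
        fun _ => []) ≤ p * A.identProb (E.pref m) D.Ttil (E.cw m) := by
  have hνT := E.ν_le_T hm
  have h := prob_inter_le_of_condProb_le _ hp
  obtain ⟨e1, e2⟩ := toReal_prob_detect D A E hm hT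
    (k := E.ν m - (E.ν (m - 1) + D.Ttil)) (by omega)
  rw [Nat.add_sub_cancel' hT.le] at e2
  have hadd := prob_inter_add_prob_inter_compl (detect D A E (E.ν (m - 1))) (correctEvent E m)
    {ω | (E.ν m : ℕ∞) ≤ alarmTime ω}
  have hcompl : {ω : List (Round K) | (E.ν m : ℕ∞) ≤ alarmTime ω}ᶜ =
      {ω | alarmTime ω < (E.ν m : ℕ∞)} := by
    ext ω
    simp
  have hadd' := congrArg ENNReal.toReal hadd
  rw [ENNReal.toReal_add (prob_ne_top _ _) (prob_ne_top _ _), e1, e2, hcompl] at hadd'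
  rw [e1] at h
  linarith

theorem identProb_mul_survAll_le {m : ℕ} (hm : m ≤ E.M)
    (hT : E.ν (m - 1) + D.Ttil < E.ν m) (hL : E.ν m + D.L / 2 ≤ E.T + 1) {q : ℝ}
    (hq : condProb (detect D A E (E.ν (m - 1)))
        {ω | ((E.ν m + D.L / 2 : ℕ) : ℕ∞) ≤ alarmTime ω}
        ({ω | (E.ν m : ℕ∞) ≤ alarmTime ω} ∩ correctEvent E m) ≤ q) :
    A.identProb (E.pref m) D.Ttil (E.cw m) *
      survAll D E (E.cw m) (E.ν m - (E.ν (m - 1) + D.Ttil) + D.L / 2) (E.ν (m - 1) + D.Ttil) 0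
        (fun _ => []) ≤
      q * (A.identProb (E.pref m) D.Ttil (E.cw m) *
        survAll D E (E.cw m) (E.ν m - (E.ν (m - 1) + D.Ttil)) (E.ν (m - 1) + D.Ttil) 0
          fun _ => []) := by
  have hνT := E.ν_le_T hm
  have h := prob_inter_le_of_condProb_le _ hq
  obtain ⟨-, e1⟩ := toReal_prob_detect D A E hm hT
    (k := E.ν m - (E.ν (m - 1) + D.Ttil)) (by omega)
  obtain ⟨-, e2⟩ := toReal_prob_detect D A E hm hT
    (k := E.ν m - (E.ν (m - 1) + D.Ttil) + D.L / 2) (by omega)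
  rw [Nat.add_sub_cancel' hT.le] at e1
  rw [← add_assoc, Nat.add_sub_cancel' hT.le] at e2
  have hset : {ω : List (Round K) | (E.ν m : ℕ∞) ≤ alarmTime ω} ∩ correctEvent E m ∩
      {ω | ((E.ν m + D.L / 2 : ℕ) : ℕ∞) ≤ alarmTime ω} =
      correctEvent E m ∩ {ω | ((E.ν m + D.L / 2 : ℕ) : ℕ∞) ≤ alarmTime ω} := by
    ext ω
    simp only [Set.mem_inter_iff, Set.mem_ofPred_eq]
    refine ⟨fun h => ⟨h.1.2, h.2⟩, fun h => ⟨⟨le_trans ?_ h.2, h.1⟩, h.2⟩⟩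
    exact_mod_cast Nat.le_add_right _ _
  rw [hset, Set.inter_comm {ω : List (Round K) | (E.ν m : ℕ∞) ≤ alarmTime ω}, e1, e2] at h
  exact h

/-- The start `t` ranges over `H + 1` times so that the statement applies to its own restarts.
Starting at most `H` late leaves at least `2 * H = D.L` detection steps in the segment, enough to
fill all windows. -/
theorem ev_regretE_segment_le (hK : 2 ≤ K) {H : ℕ} (hLH : D.L = 2 * H)
    (hlen : ∀ m, 1 ≤ m → m ≤ E.M → E.ν (m - 1) + D.Ttil + 3 * H ≤ E.ν m)
    {pT p q : ℝ}
    (hpT : ∀ m, 1 ≤ m → m ≤ E.M → pT ≤ A.identProb (E.pref m) D.Ttil (E.cw m))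
    (hp0 : 0 ≤ p) (hp1 : p ≤ 1) (hq0 : 0 ≤ q) (hq1 : q ≤ 1)
    (hp : ∀ m, 1 ≤ m → m ≤ E.M →
      condProb (detect D A E (E.ν (m - 1)))
        {ω | alarmTime ω < (E.ν m : ℕ∞)} (correctEvent E m) ≤ p)
    (hq : ∀ m, 1 ≤ m → m < E.M →
      condProb (detect D A E (E.ν (m - 1)))
        {ω | ((E.ν m + D.L / 2 : ℕ) : ℕ∞) ≤ alarmTime ω}
        ({ω | (E.ν m : ℕ∞) ≤ alarmTime ω} ∩ correctEvent E m) ≤ q)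
    {m : ℕ} (hm : m ≤ E.M) (h1 : 1 ≤ m) {t : ℕ} (ht : E.ν (m - 1) ≤ t)
    (htH : t ≤ E.ν (m - 1) + H) :
    ev (runFrom D A E (E.T + 1 - t) t State.init) (regretE E) ≤
      ENNReal.ofReal (∑ k ∈ Finset.Icc m E.M,
        (A.expRegret E (E.ν (k - 1)) D.Ttil + (H + (1 - pT + p * pT + q) * E.T))) := by
  have hH : 0 < H := by
    have : 0 < D.L := Nat.mul_pos D.w_pos (by omega)
    omega
  have hH2 : D.L / 2 = H := by omega
  have hc : ∀ m, 0 ≤ A.identProb (E.pref m) D.Ttil (E.cw m) ∧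
      A.identProb (E.pref m) D.Ttil (E.cw m) ≤ 1 := fun m => identProb_mem A _ _ _
  have hκ : 0 ≤ 1 - pT + p * pT + q := by
    have := (hpT m h1 hm).trans (hc m).2
    nlinarith
  have hr : ∀ k ∈ Finset.Icc 1 E.M,
      0 ≤ A.expRegret E (E.ν (k - 1)) D.Ttil + (H + (1 - pT + p * pT + q) * E.T) := by
    intro k hk
    have := A.expRegret_nonneg E (E.one_le_ν (by simp at hk; omega : k - 1 ≤ E.M)) D.Ttil
    positivity
  induction hm using Nat.decreasingInduction generalizing t with
  | self =>
    have hl := hlen E.M h1 le_rfl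
    have hT := E.ν_last
    have hν1 : 1 ≤ E.ν (E.M - 1) := E.one_le_ν (by omega)
    have hpref : ∀ u, E.ν (E.M - 1) ≤ u → u < E.ν E.M → E.prefAt u = E.pref E.M := by
      intro u hu1 hu2
      rw [Problem.prefAt, E.seg_eq le_rfl hu1 hu2]
    -- After the last segment nothing remains, so no delay term is needed: `ε = 0` and `C = 0`.
    have hdet := ev_regretE_detecting_le_of_no_regret D A E (C := 0) (ε := 0) le_rfl le_rfl
      (N := E.ν E.M - (t + D.Ttil)) (n := E.T + 1 - (t + D.Ttil)) (t := t + D.Ttil) (d := 0)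
      (H := 0) (E.cw E.M) (fun _ => []) (by omega) (by omega)
      (fun k hk j => E.weakRegret_cw h1 le_rfl (E.seg_eq le_rfl (by omega) (by omega)) j)
      fun d obs => ev_regretE_le_ofReal D A E
        (by rw [show E.T + 1 - (t + D.Ttil) - (E.ν E.M - (t + D.Ttil)) = 0 by omega]; simp) _ _
    rw [zero_mul, add_zero] at hdet
    have hU := survAll_le_survAll D E (E.cw E.M) (N := E.ν E.M - (t + D.Ttil))
      (N' := E.ν E.M - (E.ν (E.M - 1) + D.Ttil)) (t := t + D.Ttil)
      (t' := E.ν (E.M - 1) + D.Ttil) (P := E.pref E.M) (by omega)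
      (fun k hk => hpref _ (by omega) (by omega)) fun k hk => hpref _ (by omega) (by omega)
    have hinit := ev_regretE_init_le D A E h1 le_rfl ht (by omega) (C := 0) le_rfl
      (survAll_mem _ _ _ _ _ _ _).2 hdet
    refine hinit.trans (ENNReal.ofReal_le_ofReal ?_)
    have hκ' := one_sub_mul_le (V := 0) (hpT _ h1 le_rfl) (hc _).1 (hc _).2 hp0 hp1 hq0 hq1
      (identProb_mul_one_sub_survAll_le D A E le_rfl (by omega) (hp _ h1 le_rfl))
      (by
        rw [mul_zero]
        exact mul_nonneg hq0 (mul_nonneg (hc _).1 (survAll_mem _ _ _ _ _ _ _).1))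
      ((sub_zero _).trans_le hU)
    rw [Finset.Icc_self, Finset.sum_singleton]
    have := mul_le_mul_of_nonneg_right hκ' (Nat.cast_nonneg E.T : (0 : ℝ) ≤ E.T)
    linarith [(Nat.cast_nonneg H : (0 : ℝ) ≤ H)]
  | of_succ m hm ih =>
    have hl := hlen m h1 hm.le
    have hl' := hlen (m + 1) (by omega) hm
    rw [Nat.add_sub_cancel] at hl'
    have hνT : E.ν (m + 1) ≤ E.T + 1 := E.ν_le_T hm
    have hν1 : 1 ≤ E.ν (m - 1) := E.one_le_ν (by omega)
    have hpref : ∀ u, E.ν (m - 1) ≤ u → u < E.ν m → E.prefAt u = E.pref m := by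
      intro u hu1 hu2
      rw [Problem.prefAt, E.seg_eq hm.le hu1 hu2]
    have hpref' : ∀ u, E.ν m ≤ u → u < E.ν (m + 1) → E.prefAt u = E.pref (m + 1) := by
      intro u hu1 hu2
      rw [Problem.prefAt, E.seg_eq hm hu1 hu2]
    set S := ∑ k ∈ Finset.Icc (m + 1) E.M,
      (A.expRegret E (E.ν (k - 1)) D.Ttil + (H + (1 - pT + p * pT + q) * E.T)) with hS
    have hS0 : 0 ≤ S := Finset.sum_nonneg fun k hk => hr k (by simp at hk ⊢; omega)
    have hdet := ev_regretE_detecting_le_of_no_regret D A E (C := H + S) (ε := 1)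
      (by positivity) zero_le_one
      (N := E.ν m - (t + D.Ttil)) (n := E.T + 1 - (t + D.Ttil)) (t := t + D.Ttil) (d := 0)
      (H := H) (E.cw m) (fun _ => []) (by omega) (by omega)
      (fun k hk j => E.weakRegret_cw h1 hm.le (E.seg_eq hm.le (by omega) (by omega)) j)
      fun d obs => by
        rw [one_mul]
        refine ev_regretE_detecting_le_of_restart D A E hS0 _ _ (by omega) (by omega)
          fun l hl1 hlH => ?_
        -- An alarm within `H` steps after the changepoint restarts DETECT at `ν m + l` with `1 ≤ l
        -- ≤ H`, inside the range of starts allowed for segment `m + 1`.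
        have := ih (by omega) (t := E.ν m + l) (by simp) (by simpa using hlH)
        rwa [show E.T + 1 - (t + D.Ttil) - (E.ν m - (t + D.Ttil)) - l =
          E.T + 1 - (E.ν m + l) by omega,
          show t + D.Ttil + (E.ν m - (t + D.Ttil)) + l = E.ν m + l by omega]
    rw [one_mul, sub_add] at hdet
    have hU := survAll_sub_le_survAll_sub D E (E.cw m) hK (N := E.ν m - (t + D.Ttil))
      (N' := E.ν m - (E.ν (m - 1) + D.Ttil)) (t := t + D.Ttil)
      (t' := E.ν (m - 1) + D.Ttil) (P := E.pref m) (P' := E.pref (m + 1)) (by omega) (by omega)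
      (by omega) (fun k hk => hpref _ (by omega) (by omega))
      (fun k hk => hpref _ (by omega) (by omega)) fun k hk => hpref' _ (by omega) (by omega)
    have hV := identProb_mul_survAll_le D A E hm.le (by omega) (by omega) (hq m h1 hm)
    rw [hH2] at hU hV
    have hg : survAll D E (E.cw m) (E.ν m - (t + D.Ttil)) (t + D.Ttil) 0 (fun _ => []) -
        survAll D E (E.cw m) (E.ν m - (t + D.Ttil) + H) (t + D.Ttil) 0 (fun _ => []) ≤ 1 := by
      linarith [(survAll_mem D E (E.cw m) (E.ν m - (t + D.Ttil)) (t + D.Ttil) 0 fun _ => []).2,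
        (survAll_mem D E (E.cw m) (E.ν m - (t + D.Ttil) + H) (t + D.Ttil) 0 fun _ => []).1]
    refine (ev_regretE_init_le D A E h1 hm.le ht (by omega) (C := H + S) (by positivity) hg
      hdet).trans (ENNReal.ofReal_le_ofReal ?_)
    have hκ' := one_sub_mul_le (hpT _ h1 hm.le) (hc _).1 (hc _).2 hp0 hp1 hq0 hq1
      (identProb_mul_one_sub_survAll_le D A E hm.le (by omega) (hp _ h1 hm.le)) hV hU
    have hIcc : Finset.Icc m E.M = insert m (Finset.Icc (m + 1) E.M) := by
      ext k
      simp only [Finset.mem_Icc, Finset.mem_insert]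
      omega
    rw [hIcc, Finset.sum_insert (by simp), ← hS]
    have := mul_le_mul_of_nonneg_right hκ' (Nat.cast_nonneg E.T : (0 : ℝ) ≤ E.T)
    linarith

end main

end DuelingBandits

end

open DuelingBandits in
theorem theorem4 {K : ℕ} (hK : 2 ≤ K) (E : Problem K) (A : Algorithm K) (D : Params K)
    -- minimal segment length
    (assumption1 : ∀ m, 1 ≤ m → m ≤ E.M →
      (D.Ttil : ℝ) + 3 / 2 * (D.L : ℝ) ≤ (E.segLen m : ℝ))
    -- minimal change at every changepoint
    (c : ℝ) (hc : 0 < c)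
    (assumption2 : ∀ m, 1 ≤ m → m < E.M → 2 * D.b / (D.w : ℝ) + c ≤ E.deltaStar m)
    -- lower bound on the identification probabilities
    (pT : ℝ)
    (hpT : ∀ m, 1 ≤ m → m ≤ E.M → pT ≤ A.identProb (E.pref m) D.Ttil (E.cw m))
    (p q : ℝ) (hp0 : 0 ≤ p) (hp1 : p ≤ 1) (hq0 : 0 ≤ q) (hq1 : q ≤ 1)
    -- false alarms of DETECT initialized at the beginning of segment `m`
    (hp : ∀ m, 1 ≤ m → m ≤ E.M →
      condProb (detect D A E (E.ν (m - 1)))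
        {ω | alarmTime ω < (E.ν m : ℕ∞)} (correctEvent E m) ≤ p)
    -- large delays of DETECT initialized at the beginning of segment `m` (note that `L` is even)
    (hq : ∀ m, 1 ≤ m → m < E.M →
      condProb (detect D A E (E.ν (m - 1)))
        {ω | ((E.ν m + D.L / 2 : ℕ) : ℕ∞) ≤ alarmTime ω}
        ({ω | (E.ν m : ℕ∞) ≤ alarmTime ω} ∩ correctEvent E m) ≤ q) :
    expect (detect D A E 1) (totalRegret E) ≤
      (E.M : ℝ) * (D.L : ℝ) / 2 + (1 - pT + p * pT + q) * (E.M : ℝ) * (E.T : ℝ) +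
        ∑ m ∈ Finset.Icc 1 E.M, A.expRegret E (E.ν (m - 1)) D.Ttil := by
  obtain ⟨h, hh⟩ := D.w_even
  have hLH : D.L = 2 * (h * (K - 1)) := by
    rw [Params.L, hh]
    ring
  set H := h * (K - 1)
  have hLR : (D.L : ℝ) = 2 * (H : ℝ) := by exact_mod_cast hLH
  have hlen : ∀ m, 1 ≤ m → m ≤ E.M → E.ν (m - 1) + D.Ttil + 3 * H ≤ E.ν m := by
    intro m h1 hm
    have hle : E.ν (m - 1) ≤ E.ν m := E.ν_le_ν (by omega) hm
    have hseg := assumption1 m h1 hm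
    rw [hLR, Problem.segLen] at hseg
    have : D.Ttil + 3 * H ≤ E.ν m - E.ν (m - 1) := by
      have : ((D.Ttil + 3 * H : ℕ) : ℝ) ≤ ((E.ν m - E.ν (m - 1) : ℕ) : ℝ) := by
        push_cast at hseg ⊢
        linarith
      exact_mod_cast this
    omega
  -- The start at time `1 = ν 0` is the case of zero delay in the first segment.
  have hmain := ev_regretE_segment_le D A E hK hLH hlen hpT hp0 hp1 hq0 hq1 hp hq
    E.one_le_M le_rfl (t := 1) (by simp [E.ν_zero]) (by simp [E.ν_zero])
  have hsupp : ∀ ω ∈ (detect D A E 1).support, ∀ r ∈ ω, 1 ≤ r.time := fun ω hω =>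
    le_time_of_mem_support_runFrom D A E hω
  rw [expect_eq_toReal_ev _ fun ω hω => (ofReal_totalRegret E (hsupp ω hω)).1,
    ev_congr _ fun ω hω => (ofReal_totalRegret E (hsupp ω hω)).2]
  have hbound : (E.M : ℝ) * (D.L : ℝ) / 2 + (1 - pT + p * pT + q) * (E.M : ℝ) * (E.T : ℝ) +
      ∑ m ∈ Finset.Icc 1 E.M, A.expRegret E (E.ν (m - 1)) D.Ttil =
      ∑ m ∈ Finset.Icc 1 E.M,
        (A.expRegret E (E.ν (m - 1)) D.Ttil + (H + (1 - pT + p * pT + q) * E.T)) := by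
    rw [Finset.sum_add_distrib, Finset.sum_const, Nat.card_Icc, Nat.add_sub_cancel, nsmul_eq_mul,
      hLR]
    ring
  rw [hbound]
  refine ENNReal.toReal_le_of_le_ofReal (Finset.sum_nonneg fun m hm => ?_) hmain
  rw [Finset.mem_Icc] at hm
  have h0 := A.expRegret_nonneg E (E.one_le_ν (by omega : m - 1 ≤ E.M)) D.Ttil
  have h1 := (hpT m hm.1 hm.2).trans (identProb_mem A _ _ _).2
  have h2 : 0 ≤ 1 - pT + p * pT + q := by nlinarith
  positivity
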